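/- **Conventions.** $C^*$-algebras need not be unital. A right Hilbert $B$-module has a $B$-valued inner product $\langle x,y\rangle$ that is linear in $y$ and satisfies $\langle x,y\cdot b\rangle=\langle x,y\rangle b$; $\mathrm{End}_B(X)$ is the $C^*$-algebra of adjointable operators on $X$. A completely positive map $\rho\colon A\to\mathrm{End}_B(X)$ is *strict* if for some approximate unit $(a_i)$ of positive contractions of $A$ the nets $(\rho(a_i)x)$ and $(\rho(a_i)^*x)$ are Cauchy for every $x\in X$. A *strict positive correspondence* $(\rho,X)\colon A\to B$ is a right Hilbert $B$-module $X$ with a strict completely positive map $\rho\colon A\to\mathrm{End}_B(X)$. A *nondegenerate correspondence* $(\phi,X)\colon A\to B$ is a right Hilbert $B$-module $X$ with a $*$-homomorphism $\phi\colon A\to\mathrm{End}_B(X)$ such that $\overline{\operatorname{span}}\,\phi(A)X=X$; such a $\phi$ is a strict completely positive map. Two (positive) correspondences $(\rho,X)$, $(\sigma,Y)$ from $A$ to $B$ are isomorphic if there is an adjointable unitary $U\colon X\to Y$ with $U\rho(a)U^*=\sigma(a)$ for all $a\in A$. For a strict positive correspondence $(\rho,X)\colon A\to B$, let $A\otimes_\rho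 X$ be the Hilbert $B$-module obtained from the algebraic tensor product $A\odot X$ with the semi-inner product $\langle a_1\otimes x_1,a_2\otimes x_2\rangle=\langle x_1,\rho(a_1^*a_2)x_2\rangle$ by dividing out the vectors of length zero and completing, and let $\pi_\rho(a')(a\otimes x)=a'a\otimes x$. Then $(\pi_\rho,A\otimes_\rho X)\colon A\to B$ is a nondegenerate correspondence, the *KSGNS correspondence* of $(\rho,X)$. For a Hilbert $B$-module $X$ and a correspondence $(\phi,Y)\colon B\to C$, the balanced tensor product $X\otimes_BY$ is the completion of $X\odot Y$ for $\langle x_1\otimes y_1,x_2\otimes y_2\rangle=\langle y_1,\phi(\langle x_1,x_2\rangle)y_2\rangle$. Let $\mathbf{Quesadilla}$ have the $C^*$-algebras as objects and the isomorphism classes of strict positive correspondences $A\to B$ as arrows $A\to B$, with the composite of $(\rho,X)\colon A\to B$ and $(\sigma,Y)\colon B\to C$ given by $$\bigl(\rho\otimes\mathrm{Id},\;X\otimes_B(B\otimes_\sigma Y)\bigr)\colon A\to C .$$ Let $\mathbf{Enchilada}$ have the $C^*$-algebras as objects and the isomorphism classes of nondegenerate correspondences as arrows, with the composite of $(\phi,X)\colon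 A\to B$ and $(\psi,Y)\colon B\to C$ given by $(\phi\otimes\mathrm{Id},X\otimes_BY)$. A *semi-category* is like a category, except that identity arrows are not required; a *semi-functor* is a map on objects and arrows that preserves composition. **Proposition.** $\mathbf{Quesadilla}$ is a semi-category, and $\mathbf{Enchilada}$ is a category, the identity of $A$ being the class of $A$ as a right module over itself, with $A$ acting by left multiplication. The KSGNS construction provides a semi-functor $$\mathrm{KSGNS}\colon\mathbf{Quesadilla}\to\mathbf{Enchilada}$$ that is surjective on each set of arrows, and such that 1. $\mathrm{KSGNS}(A)=A$ for every $C^*$-algebra $A$; 2. $\mathrm{KSGNS}$ maps the class of a strict positive correspondence $(\rho,X)\colon A\to B$ to the class of $(\pi_\rho,A\otimes_\rho X)$. In particular, if $\rho$ is a nondegenerate $*$-homomorphism, then $\mathrm{KSGNS}(\rho,X)=(\rho,X)$. Let $U\colon\mathbf{Enchilada}\to\mathbf{Quesadilla}$ be the identity on objects and map the class of $(\phi,X)$ to the class of $(\phi,X)$, where the nondegenerate $*$-homomorphism $\phi$ is considered as a strict completely positive map. Then $U$ is a semi-functor, $$\mathrm{KSGNS}\circ U=\mathrm{Id}_{\mathbf{Enchilada}},\qquad\text{and}\qquad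 U\circ\mathrm{KSGNS}\ \text{is idempotent}.$$ All of this restricts to separable $C^*$-algebras and countably generated Hilbert modules: for separable $C^*$-algebras, the identity correspondences, the KSGNS correspondence of a strict positive correspondence on a countably generated module, and the composites (in $\mathbf{Quesadilla}$ and in $\mathbf{Enchilada}$) of correspondences on countably generated modules are again on countably generated modules. -/

import Mathlib

open Filter Topology
open scoped ComplexOrder InnerProductSpace TensorProduct CStarAlgebra

universe u

noncomputable section

/-! ### Right Hilbert modules and adjointable operators -/

/-- The structure of a right Hilbert `B`-module on a complex Banach space `X` (together with
`CompleteSpace X`): a right action of `B` and a `B`-valued inner product `⟪x, y⟫`, linear in `y`,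
whose associated norm is the norm of `X`. The remaining axioms of a right module (additivity and
associativity of the action) follow from these, see `HilbertModule.rsmul_mul` and its neighbours. -/
class HilbertModule (B : Type*) [NonUnitalCStarAlgebra B] [PartialOrder B] [StarOrderedRing B]
    (X : Type*) [NormedAddCommGroup X] [NormedSpace ℂ X] where
  /-- the right action `x · b` -/
  rsmul : X → B → X
  /-- the `B`-valued inner product -/
  ip : X → X → B
  ip_add_right : ∀ x y z, ip x (y + z) = ip x y + ip x z
  ip_smul_right : ∀ (c : ℂ) x y, ip x (c • y) = c • ip x y
  ip_rsmul_right : ∀ x y b, ip x (rsmul y b) = ip x y * b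
  star_ip : ∀ x y, star (ip x y) = ip y x
  ip_self_nonneg : ∀ x, 0 ≤ ip x x
  norm_sq : ∀ x, ‖x‖ ^ 2 = ‖ip x x‖

namespace HilbertModule

section semi

/-- Cauchy-Schwarz, for a semi-inner product in which the norm is not yet available. -/
lemma cauchySchwarz_aux {B : Type*} [NonUnitalCStarAlgebra B] [PartialOrder B]
    [StarOrderedRing B] {p q a : B}
    (h : ∀ t : ℝ, 0 ≤ (t ^ 2) • (star a * p * a) - (2 * t) • (star a * a) + q)
    (hp : 0 ≤ p) : ‖a‖ ^ 2 ≤ ‖p‖ * ‖q‖ := by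
  have key : ∀ t : ℝ, (2 * t - t ^ 2 * ‖p‖) * ‖a‖ ^ 2 ≤ ‖q‖ := by
    intro t
    by_cases ht : 0 ≤ 2 * t - t ^ 2 * ‖p‖
    · have h1 : star a * p * a ≤ ‖p‖ • (star a * a) :=
        CStarAlgebra.star_left_conjugate_le_norm_smul (IsSelfAdjoint.of_nonneg hp)
      have h2 : (2 * t - t ^ 2 * ‖p‖) • (star a * a) ≤ q := by
        have h3 := smul_le_smul_of_nonneg_left h1 (sq_nonneg t)
        have h4 := h t
        rw [sub_smul, mul_smul (t ^ 2)]
        rw [← sub_nonneg] at h3 ⊢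
        convert! add_nonneg h3 h4 using 1
        abel
      have h5 := CStarAlgebra.norm_le_norm_of_nonneg_of_le
        (smul_nonneg ht (star_mul_self_nonneg a)) h2
      rwa [norm_smul, CStarRing.norm_star_mul_self, Real.norm_of_nonneg ht, ← pow_two] at h5
    · nlinarith [norm_nonneg q, sq_nonneg ‖a‖]
  rcases (norm_nonneg p).eq_or_lt with h0 | h0
  · rw [← h0] at key ⊢
    by_contra! hc
    have h1 : 0 < ‖a‖ ^ 2 := by nlinarith
    have h2 := key ((‖q‖ + 1) / (2 * ‖a‖ ^ 2))
    have h3 : 2 * ((‖q‖ + 1) / (2 * ‖a‖ ^ 2)) * ‖a‖ ^ 2 = ‖q‖ + 1 := by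
      rw [div_eq_mul_inv]
      field_simp [h1.ne']
      rw [div_self (fun h => by simp [h] at h1)]
    rw [mul_zero, sub_zero, h3] at h2
    linarith
  · have h1 := key (1 / ‖p‖)
    field_simp at h1
    nlinarith

end semi

variable {B X : Type*} [NonUnitalCStarAlgebra B] [PartialOrder B] [StarOrderedRing B]
  [NormedAddCommGroup X] [NormedSpace ℂ X] [HilbertModule B X]

variable (B) in
lemma ip_self_eq_zero {x : X} : ip (B := B) x x = 0 ↔ x = 0 := by
  rw [← norm_eq_zero, ← norm_sq, sq_eq_zero_iff, norm_eq_zero]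

lemma ip_add_left (x y z : X) : ip (B := B) (x + y) z = ip x z + ip y z := by
  rw [← star_ip z, ip_add_right, star_add, star_ip, star_ip]

lemma ip_smul_left (c : ℂ) (x y : X) : ip (B := B) (c • x) y = star c • ip x y := by
  rw [← star_ip y, ip_smul_right, star_smul, star_ip]

lemma ip_rsmul_left (x y : X) (b : B) : ip (rsmul x b) y = star b * ip x y := by
  rw [← star_ip y, ip_rsmul_right, star_mul, star_ip]

variable (B) in
/-- The inner product as a sesquilinear map. -/
def ipₛₗ : X →ₗ⋆[ℂ] X →ₗ[ℂ] B :=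
  LinearMap.mk₂'ₛₗ (starRingEnd ℂ) (RingHom.id ℂ) ip ip_add_left
    (fun c x y => ip_smul_left c x y) ip_add_right ip_smul_right

@[simp] lemma ipₛₗ_apply (x y : X) : ipₛₗ B x y = ip x y := rfl

lemma ip_sub_right (x y z : X) : ip (B := B) x (y - z) = ip x y - ip x z :=
  map_sub (ipₛₗ B x) y z

lemma ip_sub_left (x y z : X) : ip (B := B) (x - y) z = ip x z - ip y z :=
  LinearMap.map_sub₂ (ipₛₗ B) x y z

lemma ip_sum_right {ι : Type*} (s : Finset ι) (x : X) (f : ι → X) :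
    ip (B := B) x (∑ i ∈ s, f i) = ∑ i ∈ s, ip x (f i) :=
  map_sum (ipₛₗ B x) f s

lemma ip_sum_left {ι : Type*} (s : Finset ι) (x : X) (f : ι → X) :
    ip (B := B) (∑ i ∈ s, f i) x = ∑ i ∈ s, ip (f i) x := by
  simp_rw [← star_ip x, ip_sum_right, star_sum]

@[simp] lemma ip_zero_right (x : X) : ip (B := B) x 0 = 0 := map_zero (ipₛₗ B x)

@[simp] lemma ip_zero_left (x : X) : ip (B := B) 0 x = 0 := by
  rw [← star_ip x, ip_zero_right, star_zero]

variable (B) in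
lemma ext_ip {x y : X} (h : ∀ z : X, ip (B := B) z x = ip z y) : x = y := by
  rw [← sub_eq_zero, ← ip_self_eq_zero B, ip_sub_right, h, sub_self]

lemma rsmul_mul (x : X) (b c : B) : rsmul x (b * c) = rsmul (rsmul x b) c :=
  ext_ip B fun z => by simp only [ip_rsmul_right, mul_assoc]

lemma rsmul_add (x : X) (b c : B) : rsmul x (b + c) = rsmul x b + rsmul x c :=
  ext_ip B fun z => by simp only [ip_rsmul_right, ip_add_right, mul_add]

lemma add_rsmul (x y : X) (b : B) : rsmul (x + y) b = rsmul x b + rsmul y b :=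
  ext_ip B fun z => by simp only [ip_rsmul_right, ip_add_right, add_mul]

lemma smul_rsmul (c : ℂ) (x : X) (b : B) : rsmul (c • x) b = c • rsmul x b :=
  ext_ip B fun z => by simp only [ip_rsmul_right, ip_smul_right, smul_mul_assoc]

lemma rsmul_smul (c : ℂ) (x : X) (b : B) : rsmul x (c • b) = c • rsmul x b :=
  ext_ip B fun z => by simp only [ip_rsmul_right, ip_smul_right, mul_smul_comm]

lemma norm_ip_le (x y : X) : ‖ip (B := B) x y‖ ≤ ‖x‖ * ‖y‖ := by
  have h := cauchySchwarz_aux (p := ip (B := B) x x) (q := ip y y) (a := ip x y) (fun t => by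
    have h0 : (0 : B) ≤ ip ((t : ℂ) • rsmul x (ip x y) - y) ((t : ℂ) • rsmul x (ip (B := B) x y) - y) :=
      ip_self_nonneg _
    convert! h0 using 1
    simp only [ip_sub_left, ip_sub_right, ip_smul_left, ip_smul_right, ip_rsmul_left,
      ip_rsmul_right, star_ip, Complex.star_def, Complex.conj_ofReal, mul_assoc]
    simp only [Complex.coe_smul, sub_mul, smul_mul_assoc, smul_sub, mul_assoc]
    rw [two_mul, add_smul, pow_two, mul_smul]
    abel) (ip_self_nonneg x)
  rw [← norm_sq, ← norm_sq, ← mul_pow] at h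
  exact le_of_sq_le_sq h (by positivity)

lemma norm_rsmul_le (x : X) (b : B) : ‖rsmul x b‖ ≤ ‖x‖ * ‖b‖ := by
  refine le_of_sq_le_sq ?_ (by positivity)
  rw [norm_sq (B := B), ip_rsmul_left, ip_rsmul_right, mul_pow, norm_sq (B := B)]
  calc ‖star b * (ip x x * b)‖ ≤ ‖star b‖ * (‖ip (B := B) x x‖ * ‖b‖) :=
        (norm_mul_le _ _).trans (by gcongr; exact norm_mul_le _ _)
    _ = _ := by rw [norm_star]; ring

lemma continuous_ip : Continuous fun p : X × X => ip (B := B) p.1 p.2 :=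
  let f : X →L⋆[ℂ] X →L[ℂ] B := (ipₛₗ B (X := X)).mkContinuous₂ 1
    fun x y => by simpa using norm_ip_le x y
  (f.continuous.comp continuous_fst).clm_apply continuous_snd

lemma norm_le_of_ip {x : X} {c : ℝ} (hc : 0 ≤ c) (h : ∀ y : X, ‖ip (B := B) y x‖ ≤ c * ‖y‖) :
    ‖x‖ ≤ c := by
  have h1 := h x
  rw [← norm_sq] at h1
  by_contra! h2
  nlinarith [norm_nonneg x]

end HilbertModule

open HilbertModule

/-- The algebra of adjointable operators on `X`: bounded operators `T` for which there is a bounded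
operator `S` with `⟪T x, y⟫ = ⟪x, S y⟫`. -/
def adjointableSubalgebra (B X : Type*) [NonUnitalCStarAlgebra B] [PartialOrder B]
    [StarOrderedRing B] [NormedAddCommGroup X] [NormedSpace ℂ X] [HilbertModule B X] :
    Subalgebra ℂ (X →L[ℂ] X) where
  carrier := {T | ∃ S : X →L[ℂ] X, ∀ x y, ip (B := B) (T x) y = ip x (S y)}
  mul_mem' := by
    rintro a b ⟨S, hS⟩ ⟨S', hS'⟩
    exact ⟨S' * S, fun x y => by simp [hS, hS']⟩
  add_mem' := by
    rintro a b ⟨S, hS⟩ ⟨S', hS'⟩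
    exact ⟨S + S', fun x y => by simp [hS, hS', ip_add_left, ip_add_right]⟩
  algebraMap_mem' := fun r => ⟨algebraMap ℂ _ (star r), fun x y => by
    simp [Algebra.algebraMap_eq_smul_one, ip_smul_left, ip_smul_right]⟩

/-- The C⋆-algebra `End_B(X)` of adjointable operators on the Hilbert module `X`. -/
def Adj (B X : Type*) [NonUnitalCStarAlgebra B] [PartialOrder B]
    [StarOrderedRing B] [NormedAddCommGroup X] [NormedSpace ℂ X] [HilbertModule B X] : Type _ :=
  ↥(adjointableSubalgebra B X)

namespace Adj

section
variable {B X : Type*} [NonUnitalCStarAlgebra B] [PartialOrder B] [StarOrderedRing B]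
  [NormedAddCommGroup X] [NormedSpace ℂ X] [HilbertModule B X]

instance : NormedRing (Adj B X) := inferInstanceAs (NormedRing ↥(adjointableSubalgebra B X))

instance : NormedAlgebra ℂ (Adj B X) :=
  inferInstanceAs (NormedAlgebra ℂ ↥(adjointableSubalgebra B X))

instance : FunLike (Adj B X) X X where
  coe T := T.1
  coe_injective _ _ h := Subtype.ext (DFunLike.coe_injective h)

instance : ContinuousLinearMapClass (Adj B X) ℂ X X where
  map_add T := map_add T.1
  map_smulₛₗ T := map_smul T.1
  map_continuous T := T.1.continuous

/-- An operator with a given adjoint. -/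
def mk' (T S : X →L[ℂ] X) (h : ∀ x y, ip (B := B) (T x) y = ip x (S y)) : Adj B X :=
  ⟨T, S, h⟩

@[ext] lemma ext {S T : Adj B X} (h : ∀ x, S x = T x) : S = T := DFunLike.ext _ _ h

@[simp] lemma mk'_apply (T S : X →L[ℂ] X) (h : ∀ x y, ip (B := B) (T x) y = ip x (S y)) (x : X) :
    mk' T S h x = T x := rfl

@[simp] lemma add_apply (S T : Adj B X) (x : X) : (S + T) x = S x + T x := rfl
@[simp] lemma sub_apply (S T : Adj B X) (x : X) : (S - T) x = S x - T x := rfl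
@[simp] lemma zero_apply (x : X) : (0 : Adj B X) x = 0 := rfl
@[simp] lemma one_apply (x : X) : (1 : Adj B X) x = x := rfl
@[simp] lemma mul_apply (S T : Adj B X) (x : X) : (S * T) x = S (T x) := rfl
@[simp] lemma smul_apply (c : ℂ) (T : Adj B X) (x : X) : (c • T) x = c • T x := rfl

lemma sum_apply {ι : Type*} (s : Finset ι) (f : ι → Adj B X) (x : X) :
    (∑ i ∈ s, f i) x = ∑ i ∈ s, f i x := by
  classical
  induction s using Finset.induction_on with
  | empty => simp
  | insert a s ha ih => simp [Finset.sum_insert ha, ih]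

lemma norm_apply_le (T : Adj B X) (x : X) : ‖T x‖ ≤ ‖T‖ * ‖x‖ := T.1.le_opNorm x

lemma norm_le_of_apply {T : Adj B X} {c : ℝ} (hc : 0 ≤ c) (h : ∀ x, ‖T x‖ ≤ c * ‖x‖) : ‖T‖ ≤ c :=
  T.1.opNorm_le_bound hc h

instance : Star (Adj B X) where
  star T := ⟨T.2.choose, T.1, fun x y => by
    rw [← star_ip, ← T.2.choose_spec, star_ip]⟩

lemma ip_apply_left (T : Adj B X) (x y : X) : ip (B := B) (T x) y = ip x (star T y) :=
  T.2.choose_spec x y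

lemma ip_apply_right (T : Adj B X) (x y : X) : ip (B := B) x (T y) = ip (star T x) y := by
  rw [← star_ip, ip_apply_left, star_ip]

lemma star_eq_of {S T : Adj B X} (h : ∀ x y, ip (B := B) (T x) y = ip x (S y)) : star T = S := by
  ext x
  exact ext_ip B fun z => by rw [← h, ip_apply_left]

@[simp] lemma star_mk' (T S : X →L[ℂ] X) (h : ∀ x y, ip (B := B) (T x) y = ip x (S y)) :
    star (mk' T S h) = mk' S T (fun x y => by rw [← star_ip, ← h, star_ip]) :=
  star_eq_of h

lemma map_rsmul (T : Adj B X) (x : X) (b : B) : T (rsmul x b) = rsmul (T x) b :=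
  ext_ip B fun z => by rw [ip_apply_right, ip_rsmul_right, ip_rsmul_right, ip_apply_right]

instance : StarRing (Adj B X) where
  star_involutive T := star_eq_of fun x y => (ip_apply_right T x y).symm
  star_mul S T := star_eq_of fun x y => by simp [ip_apply_left]
  star_add S T := star_eq_of fun x y => by simp [ip_apply_left, ip_add_left, ip_add_right]

instance : StarModule ℂ (Adj B X) where
  star_smul c T := star_eq_of fun x y => by simp [ip_apply_left, ip_smul_left, ip_smul_right]

instance : CStarRing (Adj B X) where
  norm_mul_self_le T := by
    have h : ‖T‖ ≤ √‖star T * T‖ := norm_le_of_apply (Real.sqrt_nonneg _) fun x => by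
      refine le_of_sq_le_sq ?_ (by positivity)
      rw [mul_pow, Real.sq_sqrt (norm_nonneg _), norm_sq (B := B), ip_apply_left]
      calc _ ≤ ‖x‖ * ‖(star T * T) x‖ := norm_ip_le _ _
        _ ≤ ‖x‖ * (‖star T * T‖ * ‖x‖) := by gcongr; exact norm_apply_le _ _
        _ = _ := by ring
    calc ‖T‖ * ‖T‖ ≤ √‖star T * T‖ * √‖star T * T‖ := by gcongr
      _ = _ := Real.mul_self_sqrt (norm_nonneg _)

instance [CompleteSpace X] : CompleteSpace (Adj B X) := by
  refine UniformSpace.complete_of_cauchySeq_tendsto fun u hu => ?_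
  have h1 : CauchySeq fun n => (u n).1 := hu.map uniformContinuous_subtype_val
  have h2 : CauchySeq fun n => (star (u n)).1 := by
    rw [Metric.cauchySeq_iff] at hu ⊢
    intro ε hε
    obtain ⟨N, hN⟩ := hu ε hε
    refine ⟨N, fun m hm n hn => ?_⟩
    have := hN m hm n hn
    rw [dist_eq_norm, ← norm_star, star_sub] at this
    rw [dist_eq_norm]
    exact this
  obtain ⟨T, hT⟩ := cauchySeq_tendsto_of_complete h1
  obtain ⟨S, hS⟩ := cauchySeq_tendsto_of_complete h2
  refine ⟨mk' T S fun x y => ?_, ?_⟩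
  · have a1 : Tendsto (fun n => ip (B := B) ((u n) x) y) atTop (𝓝 (ip (T x) y)) :=
      (continuous_ip.tendsto (T x, y)).comp
        ((((ContinuousLinearMap.apply ℂ X x).continuous.tendsto T).comp hT).prodMk_nhds
          tendsto_const_nhds)
    have a2 : Tendsto (fun n => ip (B := B) x (star (u n) y)) atTop (𝓝 (ip x (S y))) :=
      (continuous_ip.tendsto (x, S y)).comp
        (tendsto_const_nhds.prodMk_nhds
          (((ContinuousLinearMap.apply ℂ X y).continuous.tendsto S).comp hS))
    simp_rw [ip_apply_left] at a1
    exact tendsto_nhds_unique a1 a2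
  · exact tendsto_subtype_rng.2 hT

instance [CompleteSpace X] : CStarAlgebra (Adj B X) where

instance [CompleteSpace X] : PartialOrder (Adj B X) := CStarAlgebra.spectralOrder _

instance [CompleteSpace X] : StarOrderedRing (Adj B X) := CStarAlgebra.spectralOrderedRing _

end

end Adj

/-! ### Completion of a semi-inner product module -/

/-- A complex vector space with a right action of `B` and a `B`-valued semi-inner product. -/
structure SemiHilbert (B V : Type*) [NonUnitalCStarAlgebra B] [PartialOrder B]
    [StarOrderedRing B] [AddCommGroup V] [Module ℂ V] where
  form : V →ₗ⋆[ℂ] V →ₗ[ℂ] B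
  act : B → V →ₗ[ℂ] V
  form_act : ∀ v w b, form v (act b w) = form v w * b
  star_form : ∀ v w, star (form v w) = form w v
  form_nonneg : ∀ v, 0 ≤ form v v

namespace SemiHilbert

variable {B V : Type*} [NonUnitalCStarAlgebra B] [PartialOrder B] [StarOrderedRing B]
  [AddCommGroup V] [Module ℂ V]

lemma form_act_left (S : SemiHilbert B V) (v w : V) (b : B) :
    S.form (S.act b v) w = star b * S.form v w := by
  rw [← S.star_form w, S.form_act, star_mul, S.star_form]

lemma norm_form_le (S : SemiHilbert B V) (v w : V) :
    ‖S.form v w‖ ≤ √‖S.form v v‖ * √‖S.form w w‖ := by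
  have h := cauchySchwarz_aux (p := S.form v v) (q := S.form w w) (a := S.form v w) (fun t => by
    have h0 := S.form_nonneg ((t : ℂ) • S.act (S.form v w) v - w)
    convert! h0 using 1
    simp only [map_sub, map_smulₛₗ, LinearMap.sub_apply, LinearMap.smul_apply, RingHom.id_apply,
      S.form_act, S.form_act_left, S.star_form, Complex.conj_ofReal]
    simp only [Complex.coe_smul, smul_sub, mul_assoc]
    rw [two_mul, add_smul, pow_two, mul_smul]
    abel) (S.form_nonneg v)
  refine le_of_sq_le_sq ?_ (by positivity)
  rwa [mul_pow, Real.sq_sqrt (norm_nonneg _), Real.sq_sqrt (norm_nonneg _)]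

/-- The vector space `V`, with the seminorm `‖v‖ = ‖⟪v, v⟫‖^{1/2}`. -/
def Pre (_ : SemiHilbert B V) : Type _ := V

instance (S : SemiHilbert B V) : AddCommGroup S.Pre := inferInstanceAs (AddCommGroup V)

instance (S : SemiHilbert B V) : Module ℂ S.Pre := inferInstanceAs (Module ℂ V)

/-- The identity map from `V` to its copy carrying the seminorm. -/
def toPre (S : SemiHilbert B V) : V →ₗ[ℂ] S.Pre where
  toFun v := v
  map_add' _ _ := rfl
  map_smul' _ _ := rfl

/-- The semi-inner product, on the copy of `V` carrying the seminorm. -/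
def preForm (S : SemiHilbert B V) : S.Pre →ₗ⋆[ℂ] S.Pre →ₗ[ℂ] B := S.form

/-- A linear map on `V`, as a map on its copy carrying the seminorm. -/
def ofPre {W : Type*} [AddCommGroup W] [Module ℂ W] (S : SemiHilbert B V) (T : V →ₗ[ℂ] W) :
    S.Pre →ₗ[ℂ] W := T

instance (S : SemiHilbert B V) : Norm S.Pre := ⟨fun v => √‖S.preForm v v‖⟩

lemma Pre.norm_def (S : SemiHilbert B V) (v : S.Pre) : ‖v‖ = √‖S.preForm v v‖ := rfl

lemma Pre.norm_sq (S : SemiHilbert B V) (v : S.Pre) : ‖v‖ ^ 2 = ‖S.preForm v v‖ := by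
  rw [norm_def, Real.sq_sqrt (norm_nonneg _)]

lemma norm_preForm_le (S : SemiHilbert B V) (v w : S.Pre) : ‖S.preForm v w‖ ≤ ‖v‖ * ‖w‖ :=
  S.norm_form_le v w

lemma preCore (S : SemiHilbert B V) : SeminormedSpace.Core ℂ S.Pre where
  norm_nonneg _ := Real.sqrt_nonneg _
  norm_smul c v := by
    rw [Pre.norm_def, Pre.norm_def]
    have : S.preForm (c • v) (c • v) = star c • c • S.preForm v v := by
      simp only [map_smulₛₗ, LinearMap.smul_apply, RingHom.id_apply]
      exact smul_comm _ _ _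
    rw [this, norm_smul, norm_smul, norm_star, ← mul_assoc, Real.sqrt_mul (by positivity),
      Real.sqrt_mul_self (norm_nonneg _)]
  norm_triangle v w := by
    refine le_of_sq_le_sq ?_ (add_nonneg (Real.sqrt_nonneg _) (Real.sqrt_nonneg _))
    have h1 : S.preForm (v + w) (v + w)
        = S.preForm v v + S.preForm v w + S.preForm w v + S.preForm w w := by
      simp only [map_add, LinearMap.add_apply]
      abel
    have h2 := S.norm_preForm_le v w
    have h3 := S.norm_preForm_le w v
    rw [Pre.norm_sq, add_sq, Pre.norm_sq, Pre.norm_sq, h1]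
    calc _ ≤ ‖S.preForm v v‖ + ‖S.preForm v w‖ + ‖S.preForm w v‖ + ‖S.preForm w w‖ := by
            refine (norm_add_le _ _).trans ?_
            gcongr
            exact norm_add₃_le
      _ ≤ ‖S.preForm v v‖ + ‖v‖ * ‖w‖ + ‖w‖ * ‖v‖ + ‖S.preForm w w‖ := by gcongr
      _ = _ := by ring

instance (S : SemiHilbert B V) : SeminormedAddCommGroup S.Pre := .ofCore S.preCore

instance (S : SemiHilbert B V) : NormedSpace ℂ S.Pre where
  norm_smul_le c v := (S.preCore.norm_smul c v).le

/-- The Hausdorff completion of `V`, i.e. the completion of the quotient of `V` by the vectors of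
length zero. -/
def Comp (S : SemiHilbert B V) : Type _ := UniformSpace.Completion S.Pre

instance (S : SemiHilbert B V) : NormedAddCommGroup S.Comp :=
  inferInstanceAs (NormedAddCommGroup (UniformSpace.Completion S.Pre))

instance (S : SemiHilbert B V) : NormedSpace ℂ S.Comp :=
  inferInstanceAs (NormedSpace ℂ (UniformSpace.Completion S.Pre))

instance (S : SemiHilbert B V) : CompleteSpace S.Comp :=
  inferInstanceAs (CompleteSpace (UniformSpace.Completion S.Pre))

/-- The canonical map into the completion. -/
def coeL (S : SemiHilbert B V) : S.Pre →L[ℂ] S.Comp :=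
  UniformSpace.Completion.toComplL (𝕜 := ℂ) (E := S.Pre)

lemma norm_coeL (S : SemiHilbert B V) (v : S.Pre) : ‖S.coeL v‖ = ‖v‖ :=
  UniformSpace.Completion.norm_coe v

lemma isDenseInducing_coeL (S : SemiHilbert B V) : IsDenseInducing S.coeL :=
  UniformSpace.Completion.isDenseInducing_coe (α := S.Pre)

lemma isUniformInducing_coeL (S : SemiHilbert B V) : IsUniformInducing S.coeL :=
  UniformSpace.Completion.isUniformInducing_coe S.Pre

/-- The canonical map of `V` into the completion. -/
def toComp (S : SemiHilbert B V) : V →ₗ[ℂ] S.Comp := S.coeL.toLinearMap ∘ₗ S.toPre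

lemma norm_toComp_sq (S : SemiHilbert B V) (v : V) : ‖S.toComp v‖ ^ 2 = ‖S.form v v‖ := by
  have := Pre.norm_sq S (S.toPre v)
  rw [← norm_coeL] at this
  exact this

lemma denseRange_toComp (S : SemiHilbert B V) : DenseRange S.toComp :=
  S.isDenseInducing_coeL.dense

/-- The semi-inner product as a continuous sesquilinear map. -/
def formL (S : SemiHilbert B V) : S.Pre →L⋆[ℂ] S.Pre →L[ℂ] B :=
  S.preForm.mkContinuous₂ 1 fun v w => by
    rw [one_mul]; exact S.norm_preForm_le v w

/-- The extension of the semi-inner product to the completion. -/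
def ipComp (S : SemiHilbert B V) (x y : S.Comp) : B :=
  (S.isDenseInducing_coeL.prodMap S.isDenseInducing_coeL).extend
    (fun p : S.Pre × S.Pre => S.formL p.1 p.2) (x, y)

lemma continuous_formL (S : SemiHilbert B V) :
    Continuous fun p : S.Pre × S.Pre => S.formL p.1 p.2 :=
  (S.formL.continuous.comp continuous_fst).clm_apply continuous_snd

lemma ipComp_toComp (S : SemiHilbert B V) (v w : V) :
    S.ipComp (S.toComp v) (S.toComp w) = S.form v w :=
  (S.isDenseInducing_coeL.prodMap S.isDenseInducing_coeL).extend_eq S.continuous_formL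
    (S.toPre v, S.toPre w)

lemma continuous_ipComp (S : SemiHilbert B V) :
    Continuous fun p : S.Comp × S.Comp => S.ipComp p.1 p.2 := by
  let φ : S.Pre →+ S.Pre →+ B :=
    { toFun := fun x => (S.formL x).toLinearMap.toAddMonoidHom
      map_zero' := by ext x; simp
      map_add' := fun x y => by ext z; simp }
  have h : Continuous fun p : S.Pre × S.Pre => φ p.1 p.2 := S.continuous_formL
  let e : S.Pre →+ S.Comp := S.coeL.toLinearMap.toAddMonoidHom
  have he : IsDenseInducing e := S.isDenseInducing_coeL
  have h2 := IsDenseInducing.extend_Z_bilin (φ := φ) he he h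
  exact h2

lemma continuous_ipComp' (S : SemiHilbert B V) {α : Type*} [TopologicalSpace α]
    {f g : α → S.Comp} (hf : Continuous f) (hg : Continuous g) :
    Continuous fun a => S.ipComp (f a) (g a) :=
  S.continuous_ipComp.comp (hf.prodMk hg)

/-- The bounded operator on the completion induced by a bounded linear map. -/
def extendComp {W : Type*} [NormedAddCommGroup W] [NormedSpace ℂ W] [CompleteSpace W] (S : SemiHilbert B V)
    (T : V →ₗ[ℂ] W) (c : ℝ) (h : ∀ v, ‖T v‖ ≤ c * ‖S.toComp v‖) : S.Comp →L[ℂ] W :=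
  ((S.ofPre T).mkContinuous c fun v => by
    rw [← norm_coeL]
    exact h v).extend S.coeL

lemma extendComp_toComp {W : Type*} [NormedAddCommGroup W] [NormedSpace ℂ W] [CompleteSpace W]
    (S : SemiHilbert B V) (T : V →ₗ[ℂ] W) (c : ℝ) (h : ∀ v, ‖T v‖ ≤ c * ‖S.toComp v‖) (v : V) :
    S.extendComp T c h (S.toComp v) = T v :=
  ContinuousLinearMap.extend_eq _ S.isDenseInducing_coeL.dense S.isUniformInducing_coeL
    (S.toPre v)

lemma act_bound (S : SemiHilbert B V) (b : B) :
    ∀ v, ‖(S.toComp ∘ₗ S.act b) v‖ ≤ ‖b‖ * ‖S.toComp v‖ := by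
  refine fun v => le_of_sq_le_sq ?_ (by positivity)
  rw [LinearMap.comp_apply, norm_toComp_sq, form_act, form_act_left, mul_pow, norm_toComp_sq]
  calc ‖star b * S.form v v * b‖ ≤ ‖star b‖ * ‖S.form v v‖ * ‖b‖ :=
        (norm_mul_le _ _).trans (by gcongr; exact norm_mul_le _ _)
    _ = _ := by rw [norm_star]; ring

/-- The right action on the completion. -/
def actComp (S : SemiHilbert B V) (b : B) : S.Comp →L[ℂ] S.Comp :=
  S.extendComp (S.toComp ∘ₗ S.act b) ‖b‖ (S.act_bound b)

lemma actComp_toComp (S : SemiHilbert B V) (b : B) (v : V) :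
    S.actComp b (S.toComp v) = S.toComp (S.act b v) :=
  S.extendComp_toComp _ _ _ v

lemma ipComp_add (S : SemiHilbert B V) (x y z : S.Comp) :
    S.ipComp x (y + z) = S.ipComp x y + S.ipComp x z := by
  refine S.denseRange_toComp.induction_on₃
    (p := fun x y z => S.ipComp x (y + z) = S.ipComp x y + S.ipComp x z) ?_ ?_ x y z
  · have h1 : Continuous fun q : S.Comp × S.Comp × S.Comp => S.ipComp q.1 (q.2.1 + q.2.2) :=
      S.continuous_ipComp' (by fun_prop) (by fun_prop)
    have h2 : Continuous fun q : S.Comp × S.Comp × S.Comp => S.ipComp q.1 q.2.1 :=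
      S.continuous_ipComp' (by fun_prop) (by fun_prop)
    have h3 : Continuous fun q : S.Comp × S.Comp × S.Comp => S.ipComp q.1 q.2.2 :=
      S.continuous_ipComp' (by fun_prop) (by fun_prop)
    exact isClosed_eq h1 (h2.add h3)
  · intro a b c
    rw [← map_add, ipComp_toComp, ipComp_toComp, ipComp_toComp, map_add]

lemma ipComp_smul (S : SemiHilbert B V) (c : ℂ) (x y : S.Comp) :
    S.ipComp x (c • y) = c • S.ipComp x y := by
  refine S.denseRange_toComp.induction_on₂
    (p := fun x y => S.ipComp x (c • y) = c • S.ipComp x y) ?_ ?_ x y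
  · have h1 : Continuous fun q : S.Comp × S.Comp => S.ipComp q.1 (c • q.2) :=
      S.continuous_ipComp' continuous_fst
        ((c • ContinuousLinearMap.id ℂ S.Comp).continuous.comp continuous_snd)
    exact isClosed_eq h1 (S.continuous_ipComp.const_smul c)
  · intro a b
    rw [← map_smul, ipComp_toComp, ipComp_toComp, map_smul]

lemma ipComp_act (S : SemiHilbert B V) (x y : S.Comp) (b : B) :
    S.ipComp x (S.actComp b y) = S.ipComp x y * b := by
  refine S.denseRange_toComp.induction_on₂
    (p := fun x y => S.ipComp x (S.actComp b y) = S.ipComp x y * b) ?_ ?_ x y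
  · have h1 : Continuous fun q : S.Comp × S.Comp => S.ipComp q.1 (S.actComp b q.2) :=
      S.continuous_ipComp' (by fun_prop) (by fun_prop)
    exact isClosed_eq h1 (S.continuous_ipComp.mul continuous_const)
  · intro v w
    rw [actComp_toComp, ipComp_toComp, ipComp_toComp, form_act]

lemma star_ipComp (S : SemiHilbert B V) (x y : S.Comp) :
    star (S.ipComp x y) = S.ipComp y x := by
  refine S.denseRange_toComp.induction_on₂
    (p := fun x y => star (S.ipComp x y) = S.ipComp y x) ?_ ?_ x y
  · exact isClosed_eq S.continuous_ipComp.star (S.continuous_ipComp' (by fun_prop) (by fun_prop))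
  · intro v w
    rw [ipComp_toComp, ipComp_toComp, star_form]

lemma ipComp_self_nonneg (S : SemiHilbert B V) (x : S.Comp) : 0 ≤ S.ipComp x x := by
  refine S.denseRange_toComp.induction_on (p := fun x => 0 ≤ S.ipComp x x) x ?_ ?_
  · exact CStarAlgebra.isClosed_nonneg.preimage (S.continuous_ipComp' continuous_id continuous_id)
  · intro v
    rw [ipComp_toComp]
    exact S.form_nonneg v

lemma norm_sq_ipComp (S : SemiHilbert B V) (x : S.Comp) : ‖x‖ ^ 2 = ‖S.ipComp x x‖ := by
  refine S.denseRange_toComp.induction_on (p := fun x => ‖x‖ ^ 2 = ‖S.ipComp x x‖) x ?_ ?_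
  · exact isClosed_eq (by fun_prop) (S.continuous_ipComp' continuous_id continuous_id).norm
  · intro v
    rw [ipComp_toComp, norm_toComp_sq]

instance (S : SemiHilbert B V) : HilbertModule B S.Comp where
  rsmul x b := S.actComp b x
  ip := S.ipComp
  ip_add_right := S.ipComp_add
  ip_smul_right := S.ipComp_smul
  ip_rsmul_right := S.ipComp_act
  star_ip := S.star_ipComp
  ip_self_nonneg := S.ipComp_self_nonneg
  norm_sq := S.norm_sq_ipComp

@[simp] lemma ip_toComp (S : SemiHilbert B V) (v w : V) :
    ip (S.toComp v) (S.toComp w) = S.form v w := S.ipComp_toComp v w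

@[simp] lemma rsmul_toComp (S : SemiHilbert B V) (v : V) (b : B) :
    rsmul (S.toComp v) b = S.toComp (S.act b v) := S.actComp_toComp b v

end SemiHilbert

/-! ### The completed tensor product along a completely positive map -/

section Gram

lemma exists_star_mul_self_of_nonneg {R : Type*} [NonUnitalCStarAlgebra R] [PartialOrder R]
    [StarOrderedRing R] {a : R} (ha : 0 ≤ a) : ∃ s, a = star s * s :=
  CStarAlgebra.nonneg_iff_eq_star_mul_self.1 ha

lemma exists_posPart_negPart {R : Type*} [NonUnitalCStarAlgebra R] [PartialOrder R]
    [StarOrderedRing R] {a : R} (ha : IsSelfAdjoint a) :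
    ∃ p q : R, 0 ≤ p ∧ 0 ≤ q ∧ a = p - q ∧ p * q = 0 :=
  ⟨a⁺, a⁻, CFC.posPart_nonneg a, CFC.negPart_nonneg a, (CFC.posPart_sub_negPart a ha).symm,
    CFC.posPart_mul_negPart a⟩

variable {B X : Type*} [NonUnitalCStarAlgebra B] [PartialOrder B] [StarOrderedRing B]
  [NormedAddCommGroup X] [NormedSpace ℂ X] [HilbertModule B X]

/-- The Gram matrix of a finite family of vectors in a Hilbert module. -/
def gram {n : ℕ} (x : Fin n → X) : CStarMatrix (Fin n) (Fin n) B :=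
  CStarMatrix.ofMatrix (Matrix.of fun i j => ip (x i) (x j))

lemma gram_nonneg {n : ℕ} (x : Fin n → X) : 0 ≤ gram (B := B) x := by
  have hG : IsSelfAdjoint (gram (B := B) x) := by
    ext i j
    exact star_ip _ _
  set G := gram (B := B) x with hGdef
  obtain ⟨P, C, hP0, hC0, hPC, hmul⟩ := exists_posPart_negPart hG
  have hCs : star C = C := (IsSelfAdjoint.of_nonneg hC0).star_eq
  obtain ⟨S, hS⟩ := exists_star_mul_self_of_nonneg hC0
  have h1 : C * G * C = - (star (S * C) * (S * C)) := by
    have h2 : G * C = - (C * C) := by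
      rw [hPC, sub_mul, hmul, zero_sub]
    rw [mul_assoc, h2, star_mul, hCs, mul_assoc, ← mul_assoc (star S), ← hS, mul_neg]
  have h3 : ∀ j, 0 ≤ (C * G * C) j j := by
    intro j
    have : (C * G * C) j j = ip (∑ k, rsmul (x k) (C k j)) (∑ k, rsmul (x k) (C k j)) := by
      simp only [ip_sum_right, ip_sum_left, ip_rsmul_left, ip_rsmul_right, CStarMatrix.mul_apply,
        Finset.sum_mul]
      refine Finset.sum_congr rfl fun k _ => Finset.sum_congr rfl fun l _ => ?_
      have : C j l = star (C l j) := by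
        conv_lhs => rw [← hCs]
        rfl
      rw [this]
      rfl
    rw [this]
    exact ip_self_nonneg _
  have h4 : ∀ k j, (S * C) k j = 0 := by
    intro k j
    have h5 : ∑ k, star ((S * C) k j) * (S * C) k j = 0 := by
      refine le_antisymm ?_ (Finset.sum_nonneg fun _ _ => star_mul_self_nonneg _)
      have := h3 j
      rw [h1] at this
      exact neg_nonneg.1 this
    have h6 := (Finset.sum_eq_zero_iff_of_nonneg fun _ _ => star_mul_self_nonneg _).1 h5 k
      (Finset.mem_univ k)
    exact (CStarRing.star_mul_self_eq_zero_iff _).1 h6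
  have h5 : S * C = 0 := by
    ext k j
    exact h4 k j
  have h6 : C = 0 := by
    rw [← CStarRing.star_mul_self_eq_zero_iff, hCs]
    nth_rw 1 [hS]
    rw [mul_assoc, h5, mul_zero]
  rw [hPC, h6, sub_zero]
  exact hP0

lemma sum_ip_nonneg [CompleteSpace X] {n : ℕ} (M : CStarMatrix (Fin n) (Fin n) (Adj B X))
    (hM : 0 ≤ M) (y : Fin n → X) : 0 ≤ ∑ i, ∑ j, ip (B := B) (y i) (M i j (y j)) := by
  obtain ⟨N, rfl⟩ := exists_star_mul_self_of_nonneg hM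
  have : ∑ i, ∑ j, ip (B := B) (y i) ((star N * N) i j (y j))
      = ∑ k, ip (∑ i, N k i (y i)) (∑ i, N k i (y i)) := by
    simp only [ip_sum_right, ip_sum_left, CStarMatrix.mul_apply, Adj.sum_apply, Adj.mul_apply,
      CStarMatrix.star_apply]
    rw [Finset.sum_comm]
    simp_rw [Adj.ip_apply_left]
    refine (Finset.sum_congr rfl fun j _ => Finset.sum_comm).trans ?_
    rw [Finset.sum_comm]
  rw [this]
  exact Finset.sum_nonneg fun _ _ => ip_self_nonneg _

end Gram

section Tensor

variable {A B X Y : Type*} [NonUnitalCStarAlgebra A] [PartialOrder A] [StarOrderedRing A]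
  [NonUnitalCStarAlgebra B] [PartialOrder B] [StarOrderedRing B]
  [NormedAddCommGroup X] [NormedSpace ℂ X] [HilbertModule A X]
  [NormedAddCommGroup Y] [NormedSpace ℂ Y] [HilbertModule B Y] [CompleteSpace Y]

lemma exists_sum_tmul {X Y : Type*} [AddCommGroup X] [Module ℂ X] [AddCommGroup Y] [Module ℂ Y]
    (t : X ⊗[ℂ] Y) :
    ∃ (n : ℕ) (x : Fin n → X) (y : Fin n → Y), t = ∑ i, x i ⊗ₜ[ℂ] y i := by
  obtain ⟨s, hs⟩ := TensorProduct.exists_finset t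
  refine ⟨s.card, fun i => (s.equivFin.symm i).1.1, fun i => (s.equivFin.symm i).1.2, ?_⟩
  rw [hs, ← Finset.sum_coe_sort]
  exact (Equiv.sum_comp s.equivFin.symm fun p : s => p.1.1 ⊗ₜ[ℂ] p.1.2).symm

/-- The sesquilinear form `⟪x₁ ⊗ y₁, x₂ ⊗ y₂⟫ = ⟪y₁, ρ(⟪x₁, x₂⟫) y₂⟫` on the algebraic tensor
product. -/
def tensorForm (X : Type*) [NormedAddCommGroup X] [NormedSpace ℂ X] [HilbertModule A X]
    (ρ : A →CP Adj B Y) : X ⊗[ℂ] Y →ₗ⋆[ℂ] X ⊗[ℂ] Y →ₗ[ℂ] B :=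
  TensorProduct.lift <| LinearMap.mk₂'ₛₗ (starRingEnd ℂ) (starRingEnd ℂ)
    (fun x₁ y₁ => TensorProduct.lift <| LinearMap.mk₂ ℂ
      (fun x₂ y₂ => ip y₁ (ρ (ip x₁ x₂) y₂))
      (fun _ _ _ => by rw [ip_add_right, map_add, Adj.add_apply, ip_add_right])
      (fun _ _ _ => by rw [ip_smul_right, map_smul, Adj.smul_apply, ip_smul_right])
      (fun _ _ _ => by rw [map_add, ip_add_right])
      (fun _ _ _ => by rw [map_smul, ip_smul_right]))
    (fun _ _ _ => by
      refine TensorProduct.ext' fun _ _ => ?_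
      simp only [TensorProduct.lift.tmul, LinearMap.mk₂_apply, LinearMap.add_apply]
      rw [ip_add_left, map_add, Adj.add_apply, ip_add_right])
    (fun _ _ _ => by
      refine TensorProduct.ext' fun _ _ => ?_
      simp only [TensorProduct.lift.tmul, LinearMap.mk₂_apply, LinearMap.smul_apply]
      rw [ip_smul_left, map_smul, Adj.smul_apply, ip_smul_right]
      rfl)
    (fun _ _ _ => by
      refine TensorProduct.ext' fun _ _ => ?_
      simp only [TensorProduct.lift.tmul, LinearMap.mk₂_apply, LinearMap.add_apply]
      rw [ip_add_left])
    (fun _ _ _ => by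
      refine TensorProduct.ext' fun _ _ => ?_
      simp only [TensorProduct.lift.tmul, LinearMap.mk₂_apply, LinearMap.smul_apply]
      rw [ip_smul_left]
      rfl)

@[simp] lemma tensorForm_tmul (ρ : A →CP Adj B Y) (x₁ x₂ : X) (y₁ y₂ : Y) :
    tensorForm X ρ (x₁ ⊗ₜ y₁) (x₂ ⊗ₜ y₂) = ip y₁ (ρ (ip x₁ x₂) y₂) := rfl

lemma map_star_cp (ρ : A →CP Adj B Y) (a : A) : ρ (star a) = star (ρ a) := by
  have : a ∈ Submodule.span ℂ {a : A | 0 ≤ a} := by rw [CStarAlgebra.span_nonneg]; trivial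
  induction this using Submodule.span_induction with
  | mem x hx =>
    have h1 : 0 ≤ ρ x := by
      have := OrderHomClass.mono ρ hx
      rwa [map_zero] at this
    rw [(IsSelfAdjoint.of_nonneg hx).star_eq, (IsSelfAdjoint.of_nonneg h1).star_eq]
  | zero => simp
  | add x y _ _ hx hy => rw [star_add, map_add, hx, hy, map_add, star_add]
  | smul c x _ hx => rw [star_smul, map_smul, hx, map_smul, star_smul]

lemma star_tensorForm (ρ : A →CP Adj B Y) (s t : X ⊗[ℂ] Y) :
    star (tensorForm X ρ s t) = tensorForm X ρ t s := by
  induction s using TensorProduct.induction_on with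
  | zero => simp
  | add s₁ s₂ h₁ h₂ => rw [map_add, LinearMap.add_apply, star_add, h₁, h₂, map_add]
  | tmul x y =>
    induction t using TensorProduct.induction_on with
    | zero => simp
    | add s₁ s₂ h₁ h₂ => rw [map_add, star_add, h₁, h₂, map_add, LinearMap.add_apply]
    | tmul x' y' =>
      rw [tensorForm_tmul, tensorForm_tmul, star_ip, Adj.ip_apply_left, ← map_star_cp, star_ip]

lemma tensorForm_nonneg (ρ : A →CP Adj B Y) (t : X ⊗[ℂ] Y) : 0 ≤ tensorForm X ρ t t := by
  obtain ⟨n, x, y, rfl⟩ := exists_sum_tmul t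
  have h := sum_ip_nonneg _ (ρ.map_cstarMatrix_nonneg _ (gram_nonneg x)) y
  simp only [map_sum, LinearMap.sum_apply, tensorForm_tmul]
  rw [Finset.sum_comm]
  exact h

/-- The right action `(x ⊗ y) · b = x ⊗ y · b` on the algebraic tensor product. -/
def tensorAct (B X : Type*) {Y : Type*} [NonUnitalCStarAlgebra B] [PartialOrder B]
    [StarOrderedRing B] [AddCommGroup X] [Module ℂ X] [NormedAddCommGroup Y] [NormedSpace ℂ Y]
    [HilbertModule B Y] (b : B) : X ⊗[ℂ] Y →ₗ[ℂ] X ⊗[ℂ] Y :=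
  LinearMap.lTensor X
    { toFun := fun y => rsmul y b
      map_add' := fun _ _ => add_rsmul _ _ _
      map_smul' := fun _ _ => smul_rsmul _ _ _ }

@[simp] lemma tensorAct_tmul {B X Y : Type*} [NonUnitalCStarAlgebra B] [PartialOrder B]
    [StarOrderedRing B] [AddCommGroup X] [Module ℂ X] [NormedAddCommGroup Y] [NormedSpace ℂ Y]
    [HilbertModule B Y] (b : B) (x : X) (y : Y) :
    tensorAct B X b (x ⊗ₜ[ℂ] y) = x ⊗ₜ rsmul y b := rfl

/-- The algebraic tensor product with the semi-inner product given by `ρ`. -/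
def tensorSemi (X : Type*) [NormedAddCommGroup X] [NormedSpace ℂ X] [HilbertModule A X]
    (ρ : A →CP Adj B Y) : SemiHilbert B (X ⊗[ℂ] Y) where
  form := tensorForm X ρ
  act := tensorAct B X
  form_act s t b := by
    induction t using TensorProduct.induction_on with
    | zero => simp
    | add s₁ s₂ h₁ h₂ => rw [map_add, map_add, h₁, h₂, map_add, add_mul]
    | tmul x y =>
      induction s using TensorProduct.induction_on with
      | zero => simp
      | add s₁ s₂ h₁ h₂ => rw [map_add, LinearMap.add_apply, h₁, h₂, LinearMap.add_apply, add_mul]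
      | tmul x' y' =>
        rw [tensorAct_tmul, tensorForm_tmul, Adj.map_rsmul, ip_rsmul_right, tensorForm_tmul]
  star_form := star_tensorForm ρ
  form_nonneg := tensorForm_nonneg ρ

/-- For a Hilbert `A`-module `X`, a Hilbert `B`-module `Y` and a completely positive map
`ρ : A → End_B(Y)`, the Hilbert `B`-module `X ⊗_ρ Y`: the Hausdorff completion of the algebraic
tensor product for `⟪x₁ ⊗ y₁, x₂ ⊗ y₂⟫ = ⟪y₁, ρ(⟪x₁, x₂⟫) y₂⟫`. If `ρ` is a `*`-homomorphism this is
the internal (balanced) tensor product `X ⊗_A Y`; if `X = A` it is the KSGNS space. -/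
abbrev CPTensor (X : Type*) [NormedAddCommGroup X] [NormedSpace ℂ X] [HilbertModule A X]
    (ρ : A →CP Adj B Y) : Type _ := (tensorSemi X ρ).Comp

namespace CPTensor

variable {ρ : A →CP Adj B Y}

/-- The canonical map from the algebraic tensor product. -/
def mk (X : Type*) [NormedAddCommGroup X] [NormedSpace ℂ X] [HilbertModule A X]
    (ρ : A →CP Adj B Y) : X ⊗[ℂ] Y →ₗ[ℂ] CPTensor X ρ := (tensorSemi X ρ).toComp

lemma ip_mk (s t : X ⊗[ℂ] Y) : ip (mk X ρ s) (mk X ρ t) = tensorForm X ρ s t :=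
  (tensorSemi X ρ).ip_toComp s t

lemma denseRange_mk : DenseRange (mk X ρ) := (tensorSemi X ρ).denseRange_toComp

lemma ip_tmul (x₁ x₂ : X) (y₁ y₂ : Y) :
    ip (B := B) (mk X ρ (x₁ ⊗ₜ y₁)) (mk X ρ (x₂ ⊗ₜ y₂)) = ip y₁ (ρ (ip x₁ x₂) y₂) := by
  rw [ip_mk, tensorForm_tmul]

lemma rsmul_tmul (x : X) (y : Y) (b : B) :
    rsmul (mk X ρ (x ⊗ₜ y)) b = mk X ρ (x ⊗ₜ[ℂ] rsmul y b) :=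
  (tensorSemi X ρ).rsmul_toComp _ _

/-- Bounded operators which agree on elementary tensors are equal. -/
lemma clm_ext {W : Type*} [NormedAddCommGroup W] [NormedSpace ℂ W]
    {S T : CPTensor X ρ →L[ℂ] W} (h : ∀ x y, S (mk X ρ (x ⊗ₜ y)) = T (mk X ρ (x ⊗ₜ y))) : S = T := by
  have h1 : (S.toLinearMap ∘ₗ mk X ρ) = (T.toLinearMap ∘ₗ mk X ρ) :=
    TensorProduct.ext' h
  ext z
  refine denseRange_mk.induction_on (p := fun z => S z = T z) z
    (isClosed_eq S.continuous T.continuous) fun t => ?_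
  exact congrArg (fun f => f t) h1

lemma adj_ext {S T : Adj B (CPTensor X ρ)}
    (h : ∀ x y, S (mk X ρ (x ⊗ₜ y)) = T (mk X ρ (x ⊗ₜ y))) : S = T :=
  Subtype.ext (clm_ext h)

variable [CompleteSpace X]

lemma norm_mk_rTensor_le (T : Adj A X) (t : X ⊗[ℂ] Y) :
    ‖mk X ρ (LinearMap.rTensor Y (T : X →ₗ[ℂ] X) t)‖ ≤ ‖T‖ * ‖mk X ρ t‖ := by
  obtain ⟨S, hS⟩ := CStarAlgebra.nonneg_iff_eq_star_mul_self.1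
    (sub_nonneg.2 (CStarAlgebra.star_mul_le_algebraMap_norm_sq (a := T)))
  have key : ∀ s t : X ⊗[ℂ] Y, tensorForm X ρ (LinearMap.rTensor Y (S : X →ₗ[ℂ] X) s)
      (LinearMap.rTensor Y (S : X →ₗ[ℂ] X) t) = (‖T‖ ^ 2 : ℝ) • tensorForm X ρ s t
        - tensorForm X ρ (LinearMap.rTensor Y (T : X →ₗ[ℂ] X) s)
          (LinearMap.rTensor Y (T : X →ₗ[ℂ] X) t) := by
    intro s t
    induction s using TensorProduct.induction_on with
    | zero => simp
    | add s₁ s₂ h₁ h₂ =>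
      simp only [map_add, LinearMap.add_apply, h₁, h₂, smul_add]
      abel
    | tmul x y =>
      induction t using TensorProduct.induction_on with
      | zero => simp
      | add s₁ s₂ h₁ h₂ =>
        simp only [map_add, h₁, h₂, smul_add]
        abel
      | tmul x' y' =>
        simp only [LinearMap.rTensor_tmul, tensorForm_tmul, LinearMap.coe_coe]
        have h1 : ip (B := A) (S x) (S x')
            = ((‖T‖ ^ 2 : ℝ) : ℂ) • ip x x' - ip (T x) (T x') := by
          rw [Adj.ip_apply_left, ← Adj.mul_apply, ← hS, Adj.sub_apply, ip_sub_right,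
            Adj.ip_apply_left, ← Adj.mul_apply, ← ip_smul_right]
          congr 2
        rw [h1, map_sub, map_smul, Adj.sub_apply, Adj.smul_apply, ip_sub_right, ip_smul_right,
          Complex.coe_smul]
  refine le_of_sq_le_sq ?_ (by positivity)
  rw [HilbertModule.norm_sq (B := B), mul_pow, HilbertModule.norm_sq (B := B) (mk X ρ t), ip_mk, ip_mk]
  have h2 := tensorForm_nonneg ρ (LinearMap.rTensor Y (S : X →ₗ[ℂ] X) t)
  rw [key, sub_nonneg] at h2
  refine (CStarAlgebra.norm_le_norm_of_nonneg_of_le (tensorForm_nonneg ρ _) h2).trans ?_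
  rw [norm_smul, Real.norm_of_nonneg (sq_nonneg _)]

/-- The bounded operator `T ⊗ 1`. -/
def mapL (ρ : A →CP Adj B Y) (T : Adj A X) : CPTensor X ρ →L[ℂ] CPTensor X ρ :=
  (tensorSemi X ρ).extendComp (mk X ρ ∘ₗ LinearMap.rTensor Y (T : X →ₗ[ℂ] X)) ‖T‖
    fun t => norm_mk_rTensor_le T t

lemma mapL_mk (T : Adj A X) (t : X ⊗[ℂ] Y) :
    mapL ρ T (mk X ρ t) = mk X ρ (LinearMap.rTensor Y (T : X →ₗ[ℂ] X) t) :=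
  (tensorSemi X ρ).extendComp_toComp _ _ _ t

lemma mapL_tmul (T : Adj A X) (x : X) (y : Y) :
    mapL ρ T (mk X ρ (x ⊗ₜ y)) = mk X ρ (T x ⊗ₜ y) := mapL_mk _ _

end CPTensor

end Tensor

section Operations

variable {A B X Y : Type*} [NonUnitalCStarAlgebra A] [PartialOrder A] [StarOrderedRing A]
  [NonUnitalCStarAlgebra B] [PartialOrder B] [StarOrderedRing B]
  [NormedAddCommGroup X] [NormedSpace ℂ X] [HilbertModule A X] [CompleteSpace X]
  [NormedAddCommGroup Y] [NormedSpace ℂ Y] [HilbertModule B Y] [CompleteSpace Y]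

/-- The `*`-homomorphism `End_A(X) → End_B(X ⊗_ρ Y)`, `T ↦ T ⊗ 1`, see `ampliate_tmul`. -/
def ampliate (X : Type*) [NormedAddCommGroup X] [NormedSpace ℂ X] [HilbertModule A X]
    [CompleteSpace X] (ρ : A →CP Adj B Y) : Adj A X →⋆ₙₐ[ℂ] Adj B (CPTensor X ρ) where
  toFun T := Adj.mk' (CPTensor.mapL ρ T) (CPTensor.mapL ρ (star T)) fun z w => by
    refine CPTensor.denseRange_mk.induction_on₂
      (p := fun z w => ip (B := B) (CPTensor.mapL ρ T z) w = ip z (CPTensor.mapL ρ (star T) w))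
      ?_ ?_ z w
    · exact isClosed_eq
        (continuous_ip.comp (((CPTensor.mapL ρ T).continuous.comp continuous_fst).prodMk
          continuous_snd))
        (continuous_ip.comp (continuous_fst.prodMk
          ((CPTensor.mapL ρ (star T)).continuous.comp continuous_snd)))
    · intro s t
      rw [CPTensor.mapL_mk, CPTensor.mapL_mk, CPTensor.ip_mk, CPTensor.ip_mk]
      induction s using TensorProduct.induction_on with
      | zero => simp
      | add s₁ s₂ h₁ h₂ => simp only [map_add, LinearMap.add_apply, h₁, h₂]
      | tmul x y =>
        induction t using TensorProduct.induction_on with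
        | zero => simp
        | add s₁ s₂ h₁ h₂ => simp only [map_add, h₁, h₂]
        | tmul x' y' =>
          simp only [LinearMap.rTensor_tmul, tensorForm_tmul, LinearMap.coe_coe,
            Adj.ip_apply_left]
  map_smul' c T := CPTensor.adj_ext fun x y => by
    simp only [Adj.mk'_apply, CPTensor.mapL_tmul, Adj.smul_apply, MonoidHom.id_apply,
      ← TensorProduct.smul_tmul', map_smul]
  map_zero' := CPTensor.adj_ext fun x y => by
    simp only [Adj.mk'_apply, CPTensor.mapL_tmul, Adj.zero_apply, TensorProduct.zero_tmul, map_zero]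
  map_add' S T := CPTensor.adj_ext fun x y => by
    simp only [Adj.mk'_apply, CPTensor.mapL_tmul, Adj.add_apply, TensorProduct.add_tmul, map_add]
  map_mul' S T := CPTensor.adj_ext fun x y => by
    simp only [Adj.mk'_apply, CPTensor.mapL_tmul, Adj.mul_apply]
  map_star' T := by
    rw [Adj.star_mk']
    congr 1
    rw [star_star]

@[simp] lemma ampliate_tmul (ρ : A →CP Adj B Y) (T : Adj A X) (x : X) (y : Y) :
    ampliate X ρ T (CPTensor.mk X ρ (x ⊗ₜ y)) = CPTensor.mk X ρ (T x ⊗ₜ y) :=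
  CPTensor.mapL_tmul T x y

lemma ampliate_mk (ρ : A →CP Adj B Y) (T : Adj A X) (t : X ⊗[ℂ] Y) :
    ampliate X ρ T (CPTensor.mk X ρ t)
      = CPTensor.mk X ρ (LinearMap.rTensor Y (T : X →ₗ[ℂ] X) t) :=
  CPTensor.mapL_mk T t

lemma exists_norm_cp_le (ρ : A →CP Adj B Y) : ∃ C : ℝ, 0 ≤ C ∧ ∀ a, ‖ρ a‖ ≤ C * ‖a‖ := by
  obtain ⟨C, hC⟩ := PositiveLinearMap.exists_norm_apply_le (.ofClass ρ)
  exact ⟨C, C.2, hC⟩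

lemma exists_norm_tmul_le (X : Type*) [NormedAddCommGroup X] [NormedSpace ℂ X] [HilbertModule A X]
    (ρ : A →CP Adj B Y) :
    ∃ C : ℝ, 0 ≤ C ∧ ∀ (x : X) (y : Y), ‖CPTensor.mk X ρ (x ⊗ₜ y)‖ ≤ C * ‖x‖ * ‖y‖ := by
  obtain ⟨C, hC0, hC⟩ := exists_norm_cp_le ρ
  refine ⟨√C, Real.sqrt_nonneg _, fun x y => le_of_sq_le_sq ?_ (by positivity)⟩
  rw [HilbertModule.norm_sq (B := B), CPTensor.ip_tmul, mul_pow, mul_pow, Real.sq_sqrt hC0,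
    HilbertModule.norm_sq (B := A) x]
  calc _ ≤ ‖y‖ * ‖ρ (ip x x) y‖ := norm_ip_le _ _
    _ ≤ ‖y‖ * (C * ‖ip (B := A) x x‖ * ‖y‖) := by
      gcongr
      exact (Adj.norm_apply_le _ _).trans (by gcongr; exact hC _)
    _ = _ := by ring

/-- A completely positive map followed by a `*`-homomorphism. -/
def CompletelyPositiveMap.starComp {A B C : Type*} [NonUnitalCStarAlgebra A] [PartialOrder A]
    [StarOrderedRing A] [NonUnitalCStarAlgebra B] [PartialOrder B] [StarOrderedRing B]
    [NonUnitalCStarAlgebra C] [PartialOrder C] [StarOrderedRing C]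
    (φ : B →⋆ₙₐ[ℂ] C) (ρ : A →CP B) : A →CP C where
  toLinearMap := (φ : B →ₗ[ℂ] C) ∘ₗ ρ.toLinearMap
  map_cstarMatrix_nonneg' k M hM :=
    CompletelyPositiveMapClass.map_cstarMatrix_nonneg' φ k _ (ρ.map_cstarMatrix_nonneg' k M hM)

@[simp] lemma CompletelyPositiveMap.starComp_apply {A B C : Type*} [NonUnitalCStarAlgebra A]
    [PartialOrder A] [StarOrderedRing A] [NonUnitalCStarAlgebra B] [PartialOrder B]
    [StarOrderedRing B] [NonUnitalCStarAlgebra C] [PartialOrder C] [StarOrderedRing C]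
    (φ : B →⋆ₙₐ[ℂ] C) (ρ : A →CP B) (a : A) : ρ.starComp φ a = φ (ρ a) := rfl

/-- A `*`-homomorphism, as a completely positive map. -/
def starHomToCP {A B : Type*} [NonUnitalCStarAlgebra A] [PartialOrder A]
    [StarOrderedRing A] [NonUnitalCStarAlgebra B] [PartialOrder B] [StarOrderedRing B]
    (φ : A →⋆ₙₐ[ℂ] B) : A →CP B :=
  CompletelyPositiveMapClass.toCompletelyPositiveLinearMap φ

@[simp] lemma starHomToCP_apply {A B : Type*} [NonUnitalCStarAlgebra A] [PartialOrder A]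
    [StarOrderedRing A] [NonUnitalCStarAlgebra B] [PartialOrder B] [StarOrderedRing B]
    (φ : A →⋆ₙₐ[ℂ] B) (a : A) : starHomToCP φ a = φ a := rfl

/-! ### Strictness and nondegeneracy -/

/-- A completely positive map `ρ : A → End_B(Y)` is strict if `(ρ(a_i))_i` is Cauchy in the strict
topology (i.e. `(ρ(a_i) y)_i` and `(ρ(a_i)^* y)_i` are Cauchy for all `y`) for some approximate
unit `(a_i)_i` of positive contractions of `A`. -/
def IsStrict (ρ : A →CP Adj B Y) : Prop :=
  ∃ l : Filter A, l.IsIncreasingApproximateUnit ∧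
    ∀ y : Y, Cauchy (l.map fun a => ρ a y) ∧ Cauchy (l.map fun a => star (ρ a) y)

/-- A `*`-homomorphism `φ : A → End_B(Y)` is nondegenerate if the span of `φ(A) Y` is dense. -/
def IsNondegenerate (φ : A →⋆ₙₐ[ℂ] Adj B Y) : Prop :=
  Dense (Submodule.span ℂ {z : Y | ∃ a y, z = φ a y} : Set Y)

/-- Convergence on a dense subspace of bounded nets of operators. -/
lemma cauchy_of_dense {ι : Type*} {l : Filter ι} [l.NeBot] {T : ι → Adj B Y} {C : ℝ}
    (hC : ∀ᶠ i in l, ‖T i‖ ≤ C) {D : Set Y} (hD : Dense D)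
    (h : ∀ y ∈ D, Cauchy (l.map fun i => T i y)) (y : Y) : Cauchy (l.map fun i => T i y) := by
  have hC0 : 0 ≤ C := by
    obtain ⟨i, hi⟩ := hC.exists
    exact (norm_nonneg _).trans hi
  rw [Metric.cauchy_iff]
  refine ⟨inferInstance, fun ε hε => ?_⟩
  obtain ⟨z, hz, hyz⟩ := Metric.mem_closure_iff.1 (hD y) (ε / (3 * (C + 1))) (by positivity)
  obtain ⟨s, hs, hsz⟩ := (Metric.cauchy_iff.1 (h z hz)).2 (ε / 3) (by positivity)
  refine ⟨(fun i => T i y) '' ({i | T i z ∈ s} ∩ {i | ‖T i‖ ≤ C}),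
    image_mem_map (inter_mem hs hC), ?_⟩
  rintro _ ⟨i, ⟨hi, hi'⟩, rfl⟩ _ ⟨j, ⟨hj, hj'⟩, rfl⟩
  have h1 : ∀ i, ‖T i‖ ≤ C → dist (T i y) (T i z) < ε / 3 := by
    intro i hi
    rw [dist_eq_norm, ← map_sub]
    rw [dist_eq_norm] at hyz
    calc _ ≤ ‖T i‖ * ‖y - z‖ := Adj.norm_apply_le _ _
      _ ≤ C * ‖y - z‖ := by gcongr
      _ ≤ (C + 1) * ‖y - z‖ := by gcongr; linarith
      _ < (C + 1) * (ε / (3 * (C + 1))) := by gcongr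
      _ = ε / 3 := by field_simp
  have h2 := h1 i hi'
  have h3 := h1 j hj'
  rw [dist_comm] at h3
  have h4 := hsz _ hi _ hj
  calc dist (T i y) (T j y) ≤ dist (T i y) (T i z) + dist (T i z) (T j z) + dist (T j z) (T j y) :=
        dist_triangle4 _ _ _ _
    _ < ε := by linarith

lemma cauchy_ampliate {ι : Type*} {l : Filter ι} [l.NeBot] {T : ι → Adj A X} {C : ℝ}
    (ρ : A →CP Adj B Y) (hC : ∀ᶠ i in l, ‖T i‖ ≤ C) (h : ∀ x, Cauchy (l.map fun i => T i x))
    (z : CPTensor X ρ) : Cauchy (l.map fun i => ampliate X ρ (T i) z) := by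
  refine cauchy_of_dense (C := C) (hC.mono fun i hi =>
    (NonUnitalStarAlgHom.norm_apply_le (ampliate X ρ) (T i)).trans hi)
    (CPTensor.denseRange_mk (X := X) (ρ := ρ)) ?_ z
  rintro _ ⟨t, rfl⟩
  have key : ∃ w, Tendsto (fun i => ampliate X ρ (T i) (CPTensor.mk X ρ t)) l (𝓝 w) := by
    induction t using TensorProduct.induction_on with
    | zero => exact ⟨0, by simp⟩
    | add s₁ s₂ h₁ h₂ =>
      obtain ⟨w₁, h₁⟩ := h₁
      obtain ⟨w₂, h₂⟩ := h₂
      exact ⟨w₁ + w₂, by simpa only [map_add] using h₁.add h₂⟩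
    | tmul x y =>
      obtain ⟨x', hx'⟩ := CompleteSpace.complete (h x)
      obtain ⟨K, -, hK⟩ := exists_norm_tmul_le X ρ
      refine ⟨CPTensor.mk X ρ (x' ⊗ₜ y), ?_⟩
      simp only [ampliate_tmul]
      let f : X →L[ℂ] CPTensor X ρ :=
        ((CPTensor.mk X ρ) ∘ₗ ((TensorProduct.mk ℂ X Y).flip y)).mkContinuous (K * ‖y‖)
          fun x => (hK x y).trans (le_of_eq (by ring))
      exact (f.continuous.tendsto x').comp hx'
  obtain ⟨w, hw⟩ := key
  exact hw.cauchy_map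

lemma IsStrict.ampliate {A' : Type*} [NonUnitalCStarAlgebra A'] [PartialOrder A']
    [StarOrderedRing A'] {σ : A' →CP Adj A X} (hσ : IsStrict σ) (ρ : A →CP Adj B Y) :
    IsStrict (σ.starComp (ampliate X ρ)) := by
  obtain ⟨l, hl, h⟩ := hσ
  obtain ⟨C, hC0, hC⟩ := exists_norm_cp_le σ
  have hb : ∀ᶠ a in l, ‖σ a‖ ≤ C := hl.eventually_norm.mono fun a ha =>
    (hC a).trans (by nlinarith)
  have := hl.neBot
  refine ⟨l, hl, fun z => ⟨cauchy_ampliate ρ hb (fun x => (h x).1) z, ?_⟩⟩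
  have := cauchy_ampliate (T := fun a => star (σ a)) (C := C) ρ
    (hb.mono fun a ha => by rwa [norm_star]) (fun x => (h x).2) z
  simpa only [CompletelyPositiveMap.starComp_apply, map_star] using this

lemma IsNondegenerate.ampliate {A' : Type*} [NonUnitalCStarAlgebra A'] [PartialOrder A']
    [StarOrderedRing A'] {φ : A' →⋆ₙₐ[ℂ] Adj A X} (hφ : IsNondegenerate φ) (ρ : A →CP Adj B Y) :
    IsNondegenerate ((ampliate X ρ).comp φ) := by
  set N := Submodule.span ℂ {z : CPTensor X ρ | ∃ a w, z = ((_root_.ampliate X ρ).comp φ) a w}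
    with hN
  have h1 : ∀ (x : X) (y : Y), CPTensor.mk X ρ (x ⊗ₜ y) ∈ N.topologicalClosure := by
    intro x y
    obtain ⟨K, -, hK⟩ := exists_norm_tmul_le X ρ
    let f : X →L[ℂ] CPTensor X ρ :=
      ((CPTensor.mk X ρ) ∘ₗ ((TensorProduct.mk ℂ X Y).flip y)).mkContinuous (K * ‖y‖)
        fun x => (hK x y).trans (le_of_eq (by ring))
    have h2 : Submodule.span ℂ {z : X | ∃ a y, z = φ a y} ≤ N.comap f.toLinearMap := by
      rw [Submodule.span_le]
      rintro _ ⟨a, x', rfl⟩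
      exact Submodule.subset_span ⟨a, CPTensor.mk X ρ (x' ⊗ₜ y), (ampliate_tmul ρ (φ a) x' y).symm⟩
    have h3 : x ∈ closure (f ⁻¹' (N : Set (CPTensor X ρ))) := hφ.mono h2 x
    have h4 : Set.MapsTo f (f ⁻¹' (N : Set (CPTensor X ρ))) N := fun z hz => hz
    have h5 : f x ∈ closure (N : Set (CPTensor X ρ)) := map_mem_closure f.continuous h3 h4
    exact h5
  have h2 : ∀ t, CPTensor.mk X ρ t ∈ N.topologicalClosure := by
    intro t
    induction t using TensorProduct.induction_on with
    | zero => simp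
    | add s₁ s₂ h₁ h₂ => rw [map_add]; exact add_mem h₁ h₂
    | tmul x y => exact h1 x y
  intro z
  refine CPTensor.denseRange_mk.induction_on
    (p := fun z => z ∈ closure (N : Set (CPTensor X ρ))) z isClosed_closure h2

lemma IsNondegenerate.isStrict {φ : A →⋆ₙₐ[ℂ] Adj B Y} (hφ : IsNondegenerate φ) :
    IsStrict (starHomToCP φ) := by
  have hl := CStarAlgebra.increasingApproximateUnit A
  have := hl.neBot
  have hb : ∀ᶠ a in CStarAlgebra.approximateUnit A, ‖φ a‖ ≤ 1 := hl.eventually_norm.mono fun a ha =>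
    (NonUnitalStarAlgHom.norm_apply_le φ a).trans ha
  have h1 : ∀ y : Y, Cauchy ((CStarAlgebra.approximateUnit A).map fun a => φ a y) := by
    refine cauchy_of_dense hb hφ fun y hy => ?_
    suffices h : Tendsto (fun a => φ a y) (CStarAlgebra.approximateUnit A) (𝓝 y) from h.cauchy_map
    induction hy using Submodule.span_induction with
    | mem x hx =>
      obtain ⟨b, y, rfl⟩ := hx
      let g : Adj B Y →L[ℂ] Y := LinearMap.mkContinuous
        { toFun := fun T => T y
          map_add' := fun _ _ => rfl
          map_smul' := fun _ _ => rfl } ‖y‖ fun T => by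
            rw [mul_comm]; exact Adj.norm_apply_le T y
      have h2 : Continuous fun a => g (φ a) := g.continuous.comp (map_continuous φ)
      have h3 := (h2.tendsto b).comp (hl.tendsto_mul_right b)
      refine h3.congr fun a => ?_
      change φ (a * b) y = φ a (φ b y)
      rw [map_mul, Adj.mul_apply]
    | zero => simp
    | add x y _ _ hx hy => simpa only [map_add] using hx.add hy
    | smul c x _ hx => simpa only [map_smul] using hx.const_smul c
  refine ⟨_, hl, fun y => ⟨h1 y, ?_⟩⟩
  have h2 := h1 y
  rwa [map_congr (m₁ := fun a => φ a y) (m₂ := fun a => star (starHomToCP φ a) y)] at h2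
  filter_upwards [hl.eventually_star_eq] with a ha
  rw [starHomToCP_apply, ← map_star, ha]

end Operations

/-! ### A C⋆-algebra as a module over itself -/

section SelfModule

variable {A : Type*} [NonUnitalCStarAlgebra A] [PartialOrder A] [StarOrderedRing A]

/-- A C⋆-algebra as a right Hilbert module over itself, with `⟪a, b⟫ = a^* b`. -/
instance : HilbertModule A A where
  rsmul a b := a * b
  ip a b := star a * b
  ip_add_right _ _ _ := mul_add _ _ _
  ip_smul_right _ _ _ := mul_smul_comm _ _ _
  ip_rsmul_right _ _ _ := (mul_assoc _ _ _).symm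
  star_ip _ _ := by rw [star_mul, star_star]
  ip_self_nonneg a := star_mul_self_nonneg a
  norm_sq a := by rw [CStarRing.norm_star_mul_self, pow_two]

/-- Left multiplication, as a `*`-homomorphism `A → End_A(A)`. -/
def leftMul (A : Type*) [NonUnitalCStarAlgebra A] [PartialOrder A] [StarOrderedRing A] :
    A →⋆ₙₐ[ℂ] Adj A A where
  toFun a := Adj.mk' (ContinuousLinearMap.mul ℂ A a) (ContinuousLinearMap.mul ℂ A (star a))
    fun x y => by
      change star (a * x) * y = star x * (star a * y)
      rw [star_mul, mul_assoc]
  map_smul' c a := by ext x; simp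
  map_zero' := by ext x; simp
  map_add' a b := by ext x; simp
  map_mul' a b := by ext x; simp [mul_assoc]
  map_star' a := by
    rw [Adj.star_mk']
    congr 1
    rw [star_star]

@[simp] lemma leftMul_apply (a x : A) : leftMul A a x = a * x := rfl

lemma leftMul_nondegenerate : IsNondegenerate (leftMul A) := by
  intro x
  have hl := CStarAlgebra.increasingApproximateUnit A
  have := hl.neBot
  exact mem_closure_of_tendsto (hl.tendsto_mul_right x)
    (Eventually.of_forall fun a => Submodule.subset_span ⟨a, x, rfl⟩)

end SelfModule

/-! ### Unitary equivalence -/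

section Unitaries

/-- An adjointable unitary `U : X → Y` of Hilbert `B`-modules: a linear bijection whose inverse is
its adjoint. -/
structure ModuleUnitary (B X Y : Type*) [NonUnitalCStarAlgebra B] [PartialOrder B]
    [StarOrderedRing B] [NormedAddCommGroup X] [NormedSpace ℂ X] [HilbertModule B X]
    [NormedAddCommGroup Y] [NormedSpace ℂ Y] [HilbertModule B Y] extends X ≃ₗ[ℂ] Y where
  adjoint_eq : ∀ x y, ip (B := B) (toLinearEquiv x) y = ip x (toLinearEquiv.symm y)

namespace ModuleUnitary

variable {B X Y Z : Type*} [NonUnitalCStarAlgebra B] [PartialOrder B]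
    [StarOrderedRing B] [NormedAddCommGroup X] [NormedSpace ℂ X] [HilbertModule B X]
    [NormedAddCommGroup Y] [NormedSpace ℂ Y] [HilbertModule B Y]
    [NormedAddCommGroup Z] [NormedSpace ℂ Z] [HilbertModule B Z]

instance : CoeFun (ModuleUnitary B X Y) fun _ => X → Y := ⟨fun U => U.toLinearEquiv⟩

lemma ip_map (U : ModuleUnitary B X Y) (x x' : X) : ip (B := B) (U x) (U x') = ip x x' := by
  rw [U.adjoint_eq, LinearEquiv.symm_apply_apply]

/-- The identity. -/
def refl (B X : Type*) [NonUnitalCStarAlgebra B] [PartialOrder B]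
    [StarOrderedRing B] [NormedAddCommGroup X] [NormedSpace ℂ X] [HilbertModule B X] :
    ModuleUnitary B X X where
  toLinearEquiv := LinearEquiv.refl ℂ X
  adjoint_eq _ _ := rfl

/-- The inverse. -/
def symm (U : ModuleUnitary B X Y) : ModuleUnitary B Y X where
  toLinearEquiv := U.toLinearEquiv.symm
  adjoint_eq x y := by
    rw [← star_ip, ← U.adjoint_eq, star_ip]
    rfl

/-- The composite. -/
def trans (U : ModuleUnitary B X Y) (V : ModuleUnitary B Y Z) : ModuleUnitary B X Z where
  toLinearEquiv := U.toLinearEquiv.trans V.toLinearEquiv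
  adjoint_eq x y := by
    simp only [LinearEquiv.trans_apply, LinearEquiv.trans_symm]
    rw [V.adjoint_eq, U.adjoint_eq]

end ModuleUnitary

variable {A B X Y X' Y' : Type*} [NonUnitalCStarAlgebra A] [PartialOrder A] [StarOrderedRing A]
  [NonUnitalCStarAlgebra B] [PartialOrder B] [StarOrderedRing B]
  [NormedAddCommGroup X] [NormedSpace ℂ X] [HilbertModule A X]
  [NormedAddCommGroup Y] [NormedSpace ℂ Y] [HilbertModule B Y] [CompleteSpace Y]
  [NormedAddCommGroup X'] [NormedSpace ℂ X'] [HilbertModule A X']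
  [NormedAddCommGroup Y'] [NormedSpace ℂ Y'] [HilbertModule B Y'] [CompleteSpace Y']
  {ρ : A →CP Adj B Y} {ρ' : A →CP Adj B Y'}

/-- `W` conjugates `ρ` to `ρ'`: `W ρ(a) W^* = ρ'(a)`. -/
def Intertwines {A : Type*} {F F' : Type*} [FunLike F A (Adj B Y)] [FunLike F' A (Adj B Y')]
    (W : ModuleUnitary B Y Y') (ρ : F) (ρ' : F') : Prop :=
  ∀ a y, W (ρ a (W.toLinearEquiv.symm y)) = ρ' a y

lemma Intertwines.apply {A : Type*} {F F' : Type*} [FunLike F A (Adj B Y)] [FunLike F' A (Adj B Y')]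
    {W : ModuleUnitary B Y Y'} {ρ : F} {ρ' : F'} (h : Intertwines W ρ ρ') (a : A) (y : Y) :
    W (ρ a y) = ρ' a (W y) := by
  rw [← h, LinearEquiv.symm_apply_apply]

lemma Intertwines.symm {A : Type*} {F F' : Type*} [FunLike F A (Adj B Y)] [FunLike F' A (Adj B Y')]
    {W : ModuleUnitary B Y Y'} {ρ : F} {ρ' : F'} (h : Intertwines W ρ ρ') :
    Intertwines W.symm ρ' ρ := by
  intro a y
  change W.toLinearEquiv.symm (ρ' a (W y)) = _
  rw [← h.apply, LinearEquiv.symm_apply_apply]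

lemma Intertwines.trans {A Z : Type*} [NormedAddCommGroup Z] [NormedSpace ℂ Z] [HilbertModule B Z]
    [CompleteSpace Z] {F F' F'' : Type*} [FunLike F A (Adj B Y)] [FunLike F' A (Adj B Y')]
    [FunLike F'' A (Adj B Z)] {W : ModuleUnitary B Y Y'} {V : ModuleUnitary B Y' Z}
    {ρ : F} {ρ' : F'} {ρ'' : F''}
    (h : Intertwines W ρ ρ') (h' : Intertwines V ρ' ρ'') : Intertwines (W.trans V) ρ ρ'' := by
  intro a y
  change V (W (ρ a (W.toLinearEquiv.symm (V.toLinearEquiv.symm y)))) = _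
  rw [h, h']

lemma tensorForm_congr (U : ModuleUnitary A X X') (W : ModuleUnitary B Y Y')
    (h : Intertwines W ρ ρ') (s t : X ⊗[ℂ] Y) :
    tensorForm X' ρ' (TensorProduct.congr U.toLinearEquiv W.toLinearEquiv s)
      (TensorProduct.congr U.toLinearEquiv W.toLinearEquiv t) = tensorForm X ρ s t := by
  induction s using TensorProduct.induction_on with
  | zero => simp
  | add s₁ s₂ h₁ h₂ => simp only [map_add, LinearMap.add_apply, h₁, h₂]
  | tmul x y =>
    induction t using TensorProduct.induction_on with
    | zero => simp
    | add s₁ s₂ h₁ h₂ => simp only [map_add, h₁, h₂]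
    | tmul x' y' =>
      rw [TensorProduct.congr_tmul, TensorProduct.congr_tmul, tensorForm_tmul, tensorForm_tmul,
        U.ip_map, ← h.apply, W.ip_map]

namespace CPTensor

lemma norm_mk_congr_le (U : ModuleUnitary A X X') (W : ModuleUnitary B Y Y')
    (h : Intertwines W ρ ρ') (t : X ⊗[ℂ] Y) :
    ‖mk X' ρ' (TensorProduct.congr U.toLinearEquiv W.toLinearEquiv t)‖ ≤ 1 * ‖mk X ρ t‖ := by
  rw [one_mul]
  refine le_of_sq_le_sq (le_of_eq ?_) (norm_nonneg _)
  rw [HilbertModule.norm_sq (B := B), HilbertModule.norm_sq (B := B) (mk X ρ t), ip_mk, ip_mk,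
    tensorForm_congr U W h]

/-- The operator `U ⊗ W`. -/
def congrL (U : ModuleUnitary A X X') (W : ModuleUnitary B Y Y') (h : Intertwines W ρ ρ') :
    CPTensor X ρ →L[ℂ] CPTensor X' ρ' :=
  (tensorSemi X ρ).extendComp
    (mk X' ρ' ∘ₗ (TensorProduct.congr U.toLinearEquiv W.toLinearEquiv).toLinearMap) 1
    fun t => norm_mk_congr_le U W h t

lemma congrL_mk (U : ModuleUnitary A X X') (W : ModuleUnitary B Y Y') (h : Intertwines W ρ ρ')
    (t : X ⊗[ℂ] Y) : congrL U W h (mk X ρ t)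
      = mk X' ρ' (TensorProduct.congr U.toLinearEquiv W.toLinearEquiv t) :=
  (tensorSemi X ρ).extendComp_toComp _ _ _ t

lemma congrL_tmul (U : ModuleUnitary A X X') (W : ModuleUnitary B Y Y') (h : Intertwines W ρ ρ')
    (x : X) (y : Y) : congrL U W h (mk X ρ (x ⊗ₜ y)) = mk X' ρ' (U x ⊗ₜ W y) :=
  congrL_mk U W h _

lemma congrL_congrL (U : ModuleUnitary A X X') (W : ModuleUnitary B Y Y')
    (h : Intertwines W ρ ρ') (z : CPTensor X ρ) :
    congrL U.symm W.symm h.symm (congrL U W h z) = z := by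
  have : (congrL U.symm W.symm h.symm).comp (congrL U W h)
      = ContinuousLinearMap.id ℂ (CPTensor X ρ) := clm_ext fun x y => by
    rw [ContinuousLinearMap.comp_apply, congrL_tmul, congrL_tmul, ContinuousLinearMap.id_apply]
    simp only [ModuleUnitary.symm, LinearEquiv.symm_apply_apply]
  exact DFunLike.congr_fun this z

/-- The unitary `U ⊗ W`. -/
def congr (U : ModuleUnitary A X X') (W : ModuleUnitary B Y Y') (h : Intertwines W ρ ρ') :
    ModuleUnitary B (CPTensor X ρ) (CPTensor X' ρ') where
  toLinearMap := (congrL U W h).toLinearMap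
  invFun := congrL U.symm W.symm h.symm
  left_inv := congrL_congrL U W h
  right_inv := congrL_congrL U.symm W.symm h.symm
  adjoint_eq z w := by
    have key : ∀ z z' : CPTensor X ρ,
        ip (B := B) (congrL U W h z) (congrL U W h z') = ip z z' := by
      intro z z'
      refine denseRange_mk.induction_on₂
        (p := fun z z' => ip (B := B) (congrL U W h z) (congrL U W h z') = ip z z') ?_ ?_ z z'
      · exact isClosed_eq
          (continuous_ip.comp (((congrL U W h).continuous.comp continuous_fst).prodMk
            ((congrL U W h).continuous.comp continuous_snd))) continuous_ip
      · intro s t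
        rw [congrL_mk, congrL_mk, ip_mk, ip_mk, tensorForm_congr U W h]
    have h2 := key z (congrL U.symm W.symm h.symm w)
    rw [show congrL U W h (congrL U.symm W.symm h.symm w) = w from
      congrL_congrL U.symm W.symm h.symm w] at h2
    exact h2

lemma congr_intertwines [CompleteSpace X] [CompleteSpace X'] {A' F F' : Type*}
    [FunLike F A' (Adj A X)] [FunLike F' A' (Adj A X')] {φ : F} {φ' : F'}
    (U : ModuleUnitary A X X') (W : ModuleUnitary B Y Y') (h : Intertwines W ρ ρ')
    (hU : Intertwines U φ φ') (a : A') (z : CPTensor X ρ) :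
    congr U W h (ampliate X ρ (φ a) z) = ampliate X' ρ' (φ' a) (congr U W h z) := by
  have : (congrL U W h).comp (ampliate X ρ (φ a)).1
      = (ampliate X' ρ' (φ' a)).1.comp (congrL U W h) := clm_ext fun x y => by
    change congrL U W h (ampliate X ρ (φ a) (mk X ρ (x ⊗ₜ y)))
      = ampliate X' ρ' (φ' a) (congrL U W h (mk X ρ (x ⊗ₜ y)))
    rw [ampliate_tmul, congrL_tmul, congrL_tmul, ampliate_tmul, hU.apply]
  exact DFunLike.congr_fun this z

end CPTensor

lemma Intertwines.of_apply {A : Type*} {F F' : Type*} [FunLike F A (Adj B Y)]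
    [FunLike F' A (Adj B Y')] {W : ModuleUnitary B Y Y'} {ρ : F} {ρ' : F'}
    (h : ∀ a y, W (ρ a y) = ρ' a (W y)) : Intertwines W ρ ρ' := fun a y => by
  rw [h, LinearEquiv.apply_symm_apply]

end Unitaries

/-! ### C⋆-algebras and their correspondences -/

/-- C⋆-algebras (not necessarily unital), with their order `a ≤ b ↔ b - a` positive. -/
structure CStarAlg : Type (u + 1) where
  carrier : Type u
  [cstar : NonUnitalCStarAlgebra carrier]
  [order : PartialOrder carrier]
  [starOrdered : StarOrderedRing carrier]

attribute [instance] CStarAlg.cstar CStarAlg.order CStarAlg.starOrdered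

instance : CoeSort CStarAlg.{u} (Type u) := ⟨CStarAlg.carrier⟩

/-- A strict positive `A`-`B`-correspondence `(ρ, X)`: a right Hilbert `B`-module `X` and a strict
completely positive map `ρ : A → End_B(X)`. -/
structure PosCorr (A B : CStarAlg.{u}) : Type (u + 1) where
  X : Type u
  [normed : NormedAddCommGroup X]
  [normedSpace : NormedSpace ℂ X]
  [complete : CompleteSpace X]
  [hilbert : HilbertModule B X]
  ρ : A →CP Adj B X
  strict : IsStrict ρ

attribute [instance] PosCorr.normed PosCorr.normedSpace PosCorr.complete PosCorr.hilbert

/-- A nondegenerate `A`-`B`-correspondence `(φ, X)`: a right Hilbert `B`-module `X` and a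
nondegenerate `*`-homomorphism `φ : A → End_B(X)`. -/
structure Corr (A B : CStarAlg.{u}) : Type (u + 1) where
  X : Type u
  [normed : NormedAddCommGroup X]
  [normedSpace : NormedSpace ℂ X]
  [complete : CompleteSpace X]
  [hilbert : HilbertModule B X]
  φ : A →⋆ₙₐ[ℂ] Adj B X
  nondegenerate : IsNondegenerate φ

attribute [instance] Corr.normed Corr.normedSpace Corr.complete Corr.hilbert

/-- A Hilbert `B`-module is countably generated if some countable set generates a dense
submodule. -/
def IsCountablyGeneratedModule (B X : Type*) [NonUnitalCStarAlgebra B] [PartialOrder B]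
    [StarOrderedRing B] [NormedAddCommGroup X] [NormedSpace ℂ X] [HilbertModule B X] : Prop :=
  ∃ S : Set X, S.Countable ∧
    Dense (Submodule.span ℂ {z : X | ∃ x ∈ S, ∃ b : B, z = rsmul x b} : Set X)

namespace Corr

variable {A B C : CStarAlg.{u}}

/-- The identity correspondence `(Id, A_A)`, with `A` acting by left multiplication. -/
def id (A : CStarAlg.{u}) : Corr A A where
  X := A
  φ := leftMul A
  nondegenerate := leftMul_nondegenerate

/-- The balanced tensor product `(φ ⊗ 1, X ⊗_B Y)` of correspondences. -/
def comp (E : Corr A B) (F : Corr B C) : Corr A C where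
  X := CPTensor E.X (starHomToCP F.φ)
  φ := (ampliate E.X (starHomToCP F.φ)).comp E.φ
  nondegenerate := E.nondegenerate.ampliate _

/-- A nondegenerate correspondence, as a strict positive correspondence. -/
def toPosCorr (E : Corr A B) : PosCorr A B where
  X := E.X
  ρ := starHomToCP E.φ
  strict := E.nondegenerate.isStrict

/-- Isomorphism of correspondences: a unitary `U` with `U φ(a) U^* = ψ(a)`. -/
instance setoid (A B : CStarAlg.{u}) : Setoid (Corr A B) where
  r E F := ∃ U : ModuleUnitary B E.X F.X, Intertwines U E.φ F.φ
  iseqv :=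
    { refl := fun E => ⟨ModuleUnitary.refl B E.X, fun _ _ => rfl⟩
      symm := fun ⟨U, hU⟩ => ⟨U.symm, hU.symm⟩
      trans := fun ⟨U, hU⟩ ⟨V, hV⟩ => ⟨U.trans V, hU.trans hV⟩ }

lemma comp_congr {E E' : Corr A B} {F F' : Corr B C} (h : E ≈ E') (h' : F ≈ F') :
    E.comp F ≈ E'.comp F' := by
  obtain ⟨U, hU⟩ := h
  obtain ⟨W, hW⟩ := h'
  have hW' : Intertwines W (starHomToCP F.φ) (starHomToCP F'.φ) := hW
  exact ⟨CPTensor.congr U W hW', Intertwines.of_apply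
    fun a z => CPTensor.congr_intertwines U W hW' hU a z⟩

end Corr

namespace PosCorr

variable {A B C : CStarAlg.{u}}

/-- The KSGNS correspondence `(π_ρ, A ⊗_ρ X)`, where `π_ρ(a) (a' ⊗ x) = a a' ⊗ x`. -/
def ksgns (P : PosCorr A B) : Corr A B where
  X := CPTensor A P.ρ
  φ := (ampliate A P.ρ).comp (leftMul A)
  nondegenerate := leftMul_nondegenerate.ampliate _

/-- The composition `(ρ, X) ⊗ (σ, Y) = (ρ ⊗ 1, X ⊗_B (B ⊗_σ Y))` of strict positive
correspondences. -/
def comp (P : PosCorr A B) (Q : PosCorr B C) : PosCorr A C where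
  X := CPTensor P.X (starHomToCP Q.ksgns.φ)
  ρ := P.ρ.starComp (ampliate P.X (starHomToCP Q.ksgns.φ))
  strict := P.strict.ampliate _

/-- Isomorphism of positive correspondences: a unitary `U` with `U ρ(a) U^* = σ(a)`. -/
instance setoid (A B : CStarAlg.{u}) : Setoid (PosCorr A B) where
  r P Q := ∃ U : ModuleUnitary B P.X Q.X, Intertwines U P.ρ Q.ρ
  iseqv :=
    { refl := fun P => ⟨ModuleUnitary.refl B P.X, fun _ _ => rfl⟩
      symm := fun ⟨U, hU⟩ => ⟨U.symm, hU.symm⟩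
      trans := fun ⟨U, hU⟩ ⟨V, hV⟩ => ⟨U.trans V, hU.trans hV⟩ }

lemma ksgns_congr {P P' : PosCorr A B} (h : P ≈ P') : P.ksgns ≈ P'.ksgns := by
  obtain ⟨W, hW⟩ := h
  have hA : Intertwines (ModuleUnitary.refl A A) (leftMul A) (leftMul A) := fun _ _ => rfl
  exact ⟨CPTensor.congr (ModuleUnitary.refl A A) W hW, Intertwines.of_apply
    fun a z => CPTensor.congr_intertwines (ModuleUnitary.refl A A) W hW hA a z⟩

lemma comp_congr {P P' : PosCorr A B} {Q Q' : PosCorr B C} (h : P ≈ P') (h' : Q ≈ Q') :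
    P.comp Q ≈ P'.comp Q' := by
  obtain ⟨U, hU⟩ := h
  obtain ⟨W, hW⟩ := ksgns_congr h'
  have hW' : Intertwines W (starHomToCP Q.ksgns.φ) (starHomToCP Q'.ksgns.φ) := hW
  exact ⟨CPTensor.congr U W hW', Intertwines.of_apply
    fun a z => CPTensor.congr_intertwines U W hW' hU a z⟩

end PosCorr

lemma Corr.toPosCorr_congr {A B : CStarAlg.{u}} {E E' : Corr A B} (h : E ≈ E') :
    E.toPosCorr ≈ E'.toPosCorr := h

/-! ### Semi-categories -/

/-- A quiver with a composition of arrows. -/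
class Compositional (C : Type*) extends Quiver C where
  /-- first `f`, then `g` -/
  comp : ∀ {A B D : C}, (A ⟶ B) → (B ⟶ D) → (A ⟶ D)

/-- A quiver with a composition is a semi-category if the composition is associative. -/
def IsSemiCategory (C : Type*) [Compositional C] : Prop :=
  ∀ {A B D E : C} (f : A ⟶ B) (g : B ⟶ D) (h : D ⟶ E),
    Compositional.comp (Compositional.comp f g) h = Compositional.comp f (Compositional.comp g h)

/-- A semi-functor is a map on objects and arrows which preserves composition. -/
def IsSemiFunctor {C D : Type*} [Compositional C] [Compositional D] (F : C ⥤q D) : Prop :=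
  ∀ {X Y Z : C} (f : X ⟶ Y) (g : Y ⟶ Z),
    F.map (Compositional.comp f g) = Compositional.comp (F.map f) (F.map g)

/-- The objects of the Quesadilla semi-category: C⋆-algebras. -/
def Quesadilla : Type (u + 1) := CStarAlg.{u}

/-- The objects of the Enchilada category: C⋆-algebras. -/
def Enchilada : Type (u + 1) := CStarAlg.{u}

/-- Arrows of Quesadilla are isomorphism classes of strict positive correspondences, composed as
`(ρ, X) ⊗ (σ, Y) = (ρ ⊗ 1, X ⊗_B (B ⊗_σ Y))`. -/
instance : Compositional Quesadilla.{u} where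
  Hom A B := Quotient (PosCorr.setoid A B)
  comp := Quotient.map₂ PosCorr.comp fun _ _ h _ _ h' => PosCorr.comp_congr h h'

/-- Arrows of Enchilada are isomorphism classes of nondegenerate correspondences, composed by the
balanced tensor product. -/
instance : Compositional Enchilada.{u} where
  Hom A B := Quotient (Corr.setoid A B)
  comp := Quotient.map₂ Corr.comp fun _ _ h _ _ h' => Corr.comp_congr h h'

/-- The isomorphism class of a strict positive correspondence, as an arrow of Quesadilla. -/
def Quesadilla.mk {A B : Quesadilla.{u}} (P : PosCorr A B) : A ⟶ B := Quotient.mk _ P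

/-- The isomorphism class of a nondegenerate correspondence, as an arrow of Enchilada. -/
def Enchilada.mk {A B : Enchilada.{u}} (E : Corr A B) : A ⟶ B := Quotient.mk _ E

/-- The class of the identity correspondence. -/
def Enchilada.id (A : Enchilada.{u}) : A ⟶ A := Enchilada.mk (Corr.id A)

/-- The KSGNS construction: `A ↦ A` and `[(ρ, X)] ↦ [(π_ρ, A ⊗_ρ X)]`. -/
def KSGNS : Quesadilla.{u} ⥤q Enchilada.{u} where
  obj A := A
  map := Quotient.map PosCorr.ksgns fun _ _ => PosCorr.ksgns_congr

/-- The forgetful map `A ↦ A`, `[(φ, X)] ↦ [(φ, X)]` from Enchilada to Quesadilla, where the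
nondegenerate `*`-homomorphism `φ` is considered as a strict completely positive map. -/
def forgetful : Enchilada.{u} ⥤q Quesadilla.{u} where
  obj A := A
  map := Quotient.map Corr.toPosCorr fun _ _ => Corr.toPosCorr_congr

end

/-! All the constructions involved are instances of one: the tensor product `CPTensor X ρ`, written
X ⊗_ρ Y, along a completely positive map ρ : A → End_B(Y). With ρ a `*`-homomorphism it is the
balanced tensor product, and with X = A it is the KSGNS space. The proposition thereby reduces to
one associator and two unitors for this tensor product.

The associator `CPTensor.exists_assoc` identifies (X ⊗_ρ Y) ⊗_σ Z with X ⊗_{ρ⊗1} (Y ⊗_σ Z). Both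
spaces are completions of the same algebraic triple tensor product, and in both the inner product of
x ⊗ y ⊗ z and x' ⊗ y' ⊗ z' is ⟨z, σ(⟨y, ρ(⟨x, x'⟩) y'⟩) z'⟩. Multiplicativity of ρ or σ plays no
role, so the same unitary gives three results. For homomorphisms it is associativity in Enchilada.
For X = A it says that K(PQ) ≅ K(P) ⊗ K(Q), where K is the KSGNS construction
(`PosCorr.ksgns_comp`). Finally, a composite in Quesadilla is P ⊗ K(Q), so (PQ)R = (P ⊗ K(Q)) ⊗ K(R)
≅ P ⊗ (K(Q) ⊗ K(R)) ≅ P ⊗ K(QR) = P(QR), which is associativity in Quesadilla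
(`PosCorr.comp_assoc`).

The left unitor A ⊗_φ X ≅ X for nondegenerate φ is both the left identity law in Enchilada and the
statement K(U(E)) ≅ E. From the latter follow surjectivity of KSGNS on arrows, idempotence of U ∘
KSGNS, and compatibility of U with composition, since U(E)U(F) = E ⊗ K(U(F)) ≅ E ⊗ F. The right
unitor X ⊗_B B ≅ X gives the remaining identity law.

Each unitary comes from `ModuleUnitary.exists_of_ip_eq`: two linear maps with dense range and equal
inner products differ by a unitary. Countable generation is preserved because a dense sequence in
the middle algebra can be inserted between the generators of the two factors
(`IsCountablyGeneratedModule.cpTensor`). -/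

noncomputable section

open HilbertModule

/-! ### Unitaries from dense isometric maps -/

/-- Two linear maps with dense range and the same Gram form into complete Hilbert modules differ by
a unitary. -/
lemma ModuleUnitary.exists_of_ip_eq {B V X Y : Type*} [NonUnitalCStarAlgebra B] [PartialOrder B]
    [StarOrderedRing B] [AddCommGroup V] [Module ℂ V]
    [NormedAddCommGroup X] [NormedSpace ℂ X] [HilbertModule B X] [CompleteSpace X]
    [NormedAddCommGroup Y] [NormedSpace ℂ Y] [HilbertModule B Y] [CompleteSpace Y]
    (S : V →ₗ[ℂ] X) (T : V →ₗ[ℂ] Y) (hS : DenseRange S) (hT : DenseRange T)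
    (h : ∀ v w, ip (B := B) (T v) (T w) = ip (S v) (S w)) :
    ∃ U : ModuleUnitary B X Y, Continuous U ∧ ∀ v, U (S v) = T v := by
  have hn : ∀ v, ‖T v‖ = ‖S v‖ := fun v => by
    rw [← sq_eq_sq₀ (norm_nonneg _) (norm_nonneg _), norm_sq (B := B), norm_sq (B := B), h]
  -- `S` and `T` induce the same seminorm on `V`, so the identity of `V` extends to an isometric
  -- bijection between the two complete spaces.
  let e : X ≃ₗᵢ[ℂ] Y := (LinearEquiv.refl ℂ V).extendOfIsometry S T hS hT hn
  have he : ∀ v, e (S v) = T v :=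
    (LinearEquiv.refl ℂ V).extendOfIsometry_eq S T hS hT hn
  have hip : ∀ x x', ip (B := B) (e x) (e x') = ip x x' := by
    refine fun x x' => hS.induction_on₂
      (p := fun x x' => ip (B := B) (e x) (e x') = ip x x') ?_ ?_ x x'
    · exact isClosed_eq (continuous_ip.comp ((e.continuous.comp continuous_fst).prodMk
        (e.continuous.comp continuous_snd))) continuous_ip
    · intro v w
      rw [he, he, h]
  refine ⟨⟨e.toLinearEquiv, fun x y => ?_⟩, e.continuous, he⟩
  -- A surjection preserving inner products has its inverse as adjoint: take the second vector to be
  -- the preimage of `y`.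
  have := hip x (e.symm y)
  rwa [e.apply_symm_apply] at this

namespace CPTensor

variable {A B X Y : Type*} [NonUnitalCStarAlgebra A] [PartialOrder A] [StarOrderedRing A]
  [NonUnitalCStarAlgebra B] [PartialOrder B] [StarOrderedRing B]
  [NormedAddCommGroup X] [NormedSpace ℂ X] [HilbertModule A X]
  [NormedAddCommGroup Y] [NormedSpace ℂ Y] [HilbertModule B Y] [CompleteSpace Y]
  {ρ : A →CP Adj B Y}

variable (X ρ) in
/-- The continuous bilinear map `(x, y) ↦ x ⊗ y`. -/
def tmulL : X →L[ℂ] Y →L[ℂ] CPTensor X ρ :=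
  ((TensorProduct.mk ℂ X Y).compr₂ (mk X ρ)).mkContinuous₂ (exists_norm_tmul_le X ρ).choose
    (exists_norm_tmul_le X ρ).choose_spec.2

@[simp] lemma tmulL_apply (x : X) (y : Y) : tmulL X ρ x y = mk X ρ (x ⊗ₜ y) := rfl

/-- A submodule whose closure contains the elementary tensors of two total sets is dense. -/
lemma dense_of_tmul_mem_closure {D : Set X} {E : Set Y}
    (hD : Dense (Submodule.span ℂ D : Set X)) (hE : Dense (Submodule.span ℂ E : Set Y))
    (N : Submodule ℂ (CPTensor X ρ))
    (h : ∀ x ∈ D, ∀ y ∈ E, mk X ρ (x ⊗ₜ y) ∈ N.topologicalClosure) :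
    Dense (N : Set (CPTensor X ρ)) := by
  have h1 : ∀ x ∈ D, ∀ y, mk X ρ (x ⊗ₜ y) ∈ N.topologicalClosure := fun x hx y => by
    -- For fixed `x`, membership of x ⊗ y in a closed subspace is a closed linear condition on `y`,
    -- so it passes from `E` to all of `Y`. The same argument in the other variable then passes from
    -- `D` to all of `X`.
    have h2 : Submodule.span ℂ E ≤ N.topologicalClosure.comap (tmulL X ρ x).toLinearMap :=
      Submodule.span_le.2 fun y hy => h x hx y hy
    exact hE.induction (P := fun y => mk X ρ (x ⊗ₜ y) ∈ N.topologicalClosure) h2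
      (N.isClosed_topologicalClosure.preimage (tmulL X ρ x).continuous) y
  have h2 : ∀ x y, mk X ρ (x ⊗ₜ y) ∈ N.topologicalClosure := fun x y => by
    have h3 : Submodule.span ℂ D ≤
        N.topologicalClosure.comap ((tmulL X ρ).flip y).toLinearMap :=
      Submodule.span_le.2 fun x hx => h1 x hx y
    exact hD.induction (P := fun x => mk X ρ (x ⊗ₜ y) ∈ N.topologicalClosure) h3
      (N.isClosed_topologicalClosure.preimage ((tmulL X ρ).flip y).continuous) x
  intro z
  change z ∈ N.topologicalClosure
  refine denseRange_mk.induction_on (p := fun z => z ∈ N.topologicalClosure) z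
    N.isClosed_topologicalClosure fun t => ?_
  induction t using TensorProduct.induction_on with
  | zero => simp
  | add s t hs ht => rw [map_add]; exact add_mem hs ht
  | tmul x y => exact h2 x y

end CPTensor

/-! ### Associativity -/

section Assoc

variable {A B C X Y Z : Type*} [NonUnitalCStarAlgebra A] [PartialOrder A] [StarOrderedRing A]
  [NonUnitalCStarAlgebra B] [PartialOrder B] [StarOrderedRing B]
  [NonUnitalCStarAlgebra C] [PartialOrder C] [StarOrderedRing C]
  [NormedAddCommGroup X] [NormedSpace ℂ X] [HilbertModule A X]
  [NormedAddCommGroup Y] [NormedSpace ℂ Y] [HilbertModule B Y] [CompleteSpace Y]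
  [NormedAddCommGroup Z] [NormedSpace ℂ Z] [HilbertModule C Z] [CompleteSpace Z]

/-- The map `(x ⊗ y) ⊗ z ↦ (x ⊗ y) ⊗ z` into the left bracketing. -/
def CPTensor.mkLeft (X : Type*) [NormedAddCommGroup X] [NormedSpace ℂ X] [HilbertModule A X]
    (ρ : A →CP Adj B Y) (σ : B →CP Adj C Z) :
    (X ⊗[ℂ] Y) ⊗[ℂ] Z →ₗ[ℂ] CPTensor (CPTensor X ρ) σ :=
  mk (CPTensor X ρ) σ ∘ₗ LinearMap.rTensor Z (mk X ρ)

/-- The map `(x ⊗ y) ⊗ z ↦ x ⊗ (y ⊗ z)` into the right bracketing. -/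
def CPTensor.mkRight (X : Type*) [NormedAddCommGroup X] [NormedSpace ℂ X] [HilbertModule A X]
    (ρ : A →CP Adj B Y) (σ : B →CP Adj C Z) :
    (X ⊗[ℂ] Y) ⊗[ℂ] Z →ₗ[ℂ] CPTensor X (ρ.starComp (ampliate Y σ)) :=
  mk X (ρ.starComp (ampliate Y σ)) ∘ₗ LinearMap.lTensor X (mk Y σ) ∘ₗ
    (TensorProduct.assoc ℂ X Y Z).toLinearMap

@[simp] lemma CPTensor.mkLeft_tmul (ρ : A →CP Adj B Y) (σ : B →CP Adj C Z) (x : X) (y : Y)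
    (z : Z) : mkLeft X ρ σ ((x ⊗ₜ y) ⊗ₜ z) = mk _ σ (mk X ρ (x ⊗ₜ y) ⊗ₜ z) := rfl

@[simp] lemma CPTensor.mkRight_tmul (ρ : A →CP Adj B Y) (σ : B →CP Adj C Z) (x : X) (y : Y)
    (z : Z) : mkRight X ρ σ ((x ⊗ₜ y) ⊗ₜ z) = mk X _ (x ⊗ₜ mk Y σ (y ⊗ₜ z)) := rfl

lemma CPTensor.denseRange_mkLeft (ρ : A →CP Adj B Y) (σ : B →CP Adj C Z) :
    DenseRange (mkLeft X ρ σ) := by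
  -- Only the left factor was completed, so it suffices to test tensors whose left entry comes from
  -- the algebraic tensor product; these already lie in the range.
  refine dense_of_tmul_mem_closure (D := Set.range (mk X ρ)) (E := Set.univ)
    (denseRange_mk.mono Submodule.subset_span) (by simp) (LinearMap.range (mkLeft X ρ σ)) ?_
  rintro _ ⟨t, rfl⟩ z -
  exact Submodule.le_topologicalClosure _ ⟨t ⊗ₜ z, rfl⟩

lemma CPTensor.denseRange_mkRight (ρ : A →CP Adj B Y) (σ : B →CP Adj C Z) :
    DenseRange (mkRight X ρ σ) := by
  refine dense_of_tmul_mem_closure (D := Set.univ) (E := Set.range (mk Y σ))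
    (by simp) (denseRange_mk.mono Submodule.subset_span) (LinearMap.range (mkRight X ρ σ)) ?_
  rintro x - _ ⟨t, rfl⟩
  refine Submodule.le_topologicalClosure _ ⟨(TensorProduct.assoc ℂ X Y Z).symm (x ⊗ₜ t), ?_⟩
  simp [mkRight]

/-- On elementary tensors both sides unfold to ⟨z, σ(⟨y, ρ(⟨x, x'⟩) y'⟩) z'⟩: on the left the inner
product of X ⊗_ρ Y is fed into σ, on the right ρ(⟨x, x'⟩) acts on the first leg of Y ⊗_σ Z.
Sesquilinearity does the rest. -/
lemma CPTensor.ip_mkLeft (ρ : A →CP Adj B Y) (σ : B →CP Adj C Z) (s t : (X ⊗[ℂ] Y) ⊗[ℂ] Z) :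
    ip (B := C) (mkLeft X ρ σ s) (mkLeft X ρ σ t) = ip (mkRight X ρ σ s) (mkRight X ρ σ t) := by
  induction s using TensorProduct.induction_on with
  | zero => simp
  | add s₁ s₂ h₁ h₂ => simp only [map_add, ip_add_left, h₁, h₂]
  | tmul p z =>
    induction t using TensorProduct.induction_on with
    | zero => simp
    | add s₁ s₂ h₁ h₂ => simp only [map_add, ip_add_right, h₁, h₂]
    | tmul q z' =>
      induction p using TensorProduct.induction_on with
      | zero => simp
      | add s₁ s₂ h₁ h₂ => simp only [TensorProduct.add_tmul, map_add, ip_add_left, h₁, h₂]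
      | tmul x y =>
        induction q using TensorProduct.induction_on with
        | zero => simp
        | add s₁ s₂ h₁ h₂ => simp only [TensorProduct.add_tmul, map_add, ip_add_right, h₁, h₂]
        | tmul x' y' =>
          rw [mkLeft_tmul, mkLeft_tmul, mkRight_tmul, mkRight_tmul, ip_tmul, ip_tmul, ip_tmul,
            CompletelyPositiveMap.starComp_apply, ampliate_tmul, ip_tmul]

/-- The associator `(X ⊗_ρ Y) ⊗_σ Z ≅ X ⊗_{ρ ⊗ 1} (Y ⊗_σ Z)`, for completely positive `ρ` and
`σ`. It commutes with the operators on `X`. -/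
lemma CPTensor.exists_assoc [CompleteSpace X] (ρ : A →CP Adj B Y) (σ : B →CP Adj C Z) :
    ∃ U : ModuleUnitary C (CPTensor (CPTensor X ρ) σ) (CPTensor X (ρ.starComp (ampliate Y σ))),
      ∀ (T : Adj A X) z, U (ampliate (CPTensor X ρ) σ (ampliate X ρ T) z)
        = ampliate X (ρ.starComp (ampliate Y σ)) T (U z) := by
  obtain ⟨U, hUc, hU⟩ := ModuleUnitary.exists_of_ip_eq (B := C) (mkLeft X ρ σ) (mkRight X ρ σ)
    (denseRange_mkLeft ρ σ) (denseRange_mkRight ρ σ) fun s t => (ip_mkLeft ρ σ s t).symm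
  refine ⟨U, fun T z => ?_⟩
  -- Both sides are continuous and linear in `z`, so elementary triple tensors suffice. There both
  -- equal T x ⊗ (y ⊗ z).
  refine (denseRange_mkLeft ρ σ).induction_on (p := fun z =>
    U (ampliate (CPTensor X ρ) σ (ampliate X ρ T) z)
        = ampliate X (ρ.starComp (ampliate Y σ)) T (U z)) z
    (isClosed_eq (hUc.comp (map_continuous _)) ((map_continuous _).comp hUc)) fun t => ?_
  induction t using TensorProduct.induction_on with
  | zero => simp
  | add s₁ s₂ h₁ h₂ => simp only [map_add, h₁, h₂]
  | tmul p z =>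
    induction p using TensorProduct.induction_on with
    | zero => simp
    | add s₁ s₂ h₁ h₂ => simp only [TensorProduct.add_tmul, map_add, h₁, h₂]
    | tmul x y =>
      rw [hU, mkLeft_tmul, ampliate_tmul, ampliate_tmul, mkRight_tmul, ampliate_tmul,
        ← mkLeft_tmul, hU, mkRight_tmul]

end Assoc

/-! ### Units -/

section Unit

variable {A B X : Type*} [NonUnitalCStarAlgebra A] [PartialOrder A] [StarOrderedRing A]
  [NonUnitalCStarAlgebra B] [PartialOrder B] [StarOrderedRing B]
  [NormedAddCommGroup X] [NormedSpace ℂ X] [HilbertModule B X]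

/-- A map on elementary tensors which preserves the inner product and has total range extends to a
unitary. -/
lemma CPTensor.exists_unitary_of_tmul {W : Type*} [NormedAddCommGroup W] [NormedSpace ℂ W]
    [HilbertModule A W] [CompleteSpace X]
    {Y : Type*} [NormedAddCommGroup Y] [NormedSpace ℂ Y] [HilbertModule B Y] [CompleteSpace Y]
    (ρ : A →CP Adj B Y) (f : W →ₗ[ℂ] Y →ₗ[ℂ] X)
    (hf : ∀ w w' y y', ip (B := B) (f w y) (f w' y') = ip y (ρ (ip w w') y'))
    (hd : Dense (Submodule.span ℂ {z : X | ∃ w y, z = f w y} : Set X)) :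
    ∃ U : ModuleUnitary B (CPTensor W ρ) X, Continuous U ∧
      ∀ w y, U (mk W ρ (w ⊗ₜ y)) = f w y := by
  -- Totality of the values of `f` is what makes the range of its linearisation on the algebraic
  -- tensor product dense.
  have hle : Submodule.span ℂ {z : X | ∃ w y, z = f w y} ≤
      LinearMap.range (TensorProduct.lift f) :=
    Submodule.span_le.2 (by rintro _ ⟨w, y, rfl⟩; exact ⟨w ⊗ₜ y, rfl⟩)
  obtain ⟨U, hUc, hU⟩ := ModuleUnitary.exists_of_ip_eq (B := B) (mk W ρ) (TensorProduct.lift f)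
    denseRange_mk (hd.mono hle) fun s t => by
    rw [ip_mk]
    induction s using TensorProduct.induction_on with
    | zero => simp
    | add s₁ s₂ h₁ h₂ => simp only [map_add, ip_add_left, LinearMap.add_apply, h₁, h₂]
    | tmul w y =>
      induction t using TensorProduct.induction_on with
      | zero => simp
      | add s₁ s₂ h₁ h₂ => simp only [map_add, ip_add_right, h₁, h₂]
      | tmul w' y' => exact hf w w' y y'
  exact ⟨U, hUc, fun w y => hU _⟩

/-- `A ⊗_φ X ≅ X` for a nondegenerate `*`-homomorphism `φ : A → End_B(X)`. -/
lemma CPTensor.exists_leftUnitor [CompleteSpace X] {φ : A →⋆ₙₐ[ℂ] Adj B X}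
    (hφ : IsNondegenerate φ) :
    ∃ U : ModuleUnitary B (CPTensor A (starHomToCP φ)) X,
      Intertwines U ((ampliate A (starHomToCP φ)).comp (leftMul A)) φ := by
  -- The unitary is a ⊗ x ↦ φ(a) x. It preserves inner products because φ(a)^* φ(a') = φ(a^* a'),
  -- and its total range is precisely nondegeneracy of φ.
  obtain ⟨U, hUc, hU⟩ := CPTensor.exists_unitary_of_tmul (B := B) (X := X) (starHomToCP φ)
    (LinearMap.mk₂ ℂ (fun (a : A) (x : X) => φ a x) (fun _ _ _ => by rw [map_add, Adj.add_apply])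
      (fun _ _ _ => by rw [map_smul, Adj.smul_apply]) (fun _ _ _ => map_add _ _ _)
      (fun _ _ _ => map_smul _ _ _))
    (fun a a' x x' => by
      change ip (φ a x) (φ a' x') = ip x (φ (star a * a') x')
      rw [map_mul, map_star, Adj.mul_apply, Adj.ip_apply_left]) hφ
  refine ⟨U, Intertwines.of_apply fun a z => ?_⟩
  change U (ampliate A (starHomToCP φ) (leftMul A a) z) = φ a (U z)
  refine CPTensor.denseRange_mk.induction_on (p := fun z =>
    U (ampliate A (starHomToCP φ) (leftMul A a) z) = φ a (U z)) z
    (isClosed_eq (hUc.comp (map_continuous _)) ((map_continuous _).comp hUc)) fun t => ?_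
  induction t using TensorProduct.induction_on with
  | zero => simp
  | add s t hs ht => simp only [map_add, hs, ht]
  | tmul b x =>
    rw [ampliate_tmul, hU, hU]
    change φ (a * b) x = φ a (φ b x)
    rw [map_mul, Adj.mul_apply]

/-- With p = ⟨x, x⟩, expanding the square gives ‖x·b − x‖² = ‖b^*(pb − p) − (pb − p)‖, which is at
most 2‖pb − p‖ when ‖b‖ ≤ 1. Convergence in the module is thus reduced to that of an approximate
unit in `B`. -/
lemma HilbertModule.tendsto_rsmul {l : Filter B} (hl : l.IsIncreasingApproximateUnit) (x : X) :
    Tendsto (fun b => rsmul x b) l (𝓝 x) := by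
  rw [tendsto_iff_norm_sub_tendsto_zero]
  set p : B := ip x x
  -- The bound is kept as a sum of two equal terms to match the triangle inequality used below.
  have h1 : Tendsto (fun b => ‖p * b - p‖ + ‖p * b - p‖) l (𝓝 0) := by
    have := tendsto_iff_norm_sub_tendsto_zero.1 (hl.tendsto_mul_left p)
    simpa using this.add this
  have h2 : Tendsto (fun b => ‖rsmul x b - x‖ ^ 2) l (𝓝 0) := by
    refine squeeze_zero' (Eventually.of_forall fun b => sq_nonneg _) ?_ h1
    filter_upwards [hl.eventually_norm] with b hb
    have h3 : ip (B := B) (rsmul x b - x) (rsmul x b - x) = star b * (p * b - p) - (p * b - p) := by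
      rw [ip_sub_left, ip_sub_right, ip_sub_right, ip_rsmul_left, ip_rsmul_left, ip_rsmul_right,
        mul_sub]
    rw [norm_sq (B := B), h3]
    refine (norm_sub_le _ _).trans ?_
    gcongr
    refine (norm_mul_le _ _).trans ?_
    rw [norm_star]
    exact mul_le_of_le_one_left (norm_nonneg _) hb
  simpa using h2.sqrt

-- Each `x` is the limit of x·b along an approximate unit of `B`, so a possibly nonunital algebra
-- still acts with total range. This is the surjectivity needed for the right unitor.
variable (B X) in
lemma HilbertModule.dense_span_rsmul :
    Dense (Submodule.span ℂ {z : X | ∃ (x : X) (b : B), z = rsmul x b} : Set X) := fun x =>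
  have hl := CStarAlgebra.increasingApproximateUnit B
  have := hl.neBot
  mem_closure_of_tendsto (tendsto_rsmul hl x)
    (Eventually.of_forall fun b => Submodule.subset_span ⟨x, b, rfl⟩)

variable (B X) in
/-- `X ⊗_B B ≅ X`. -/
lemma CPTensor.exists_rightUnitor [CompleteSpace X] :
    ∃ U : ModuleUnitary B (CPTensor X (starHomToCP (leftMul B))) X,
      ∀ (T : Adj B X) z, U (ampliate X (starHomToCP (leftMul B)) T z) = T (U z) := by
  -- The unitary is x ⊗ b ↦ x·b. It commutes with every adjointable `T` because such operators are
  -- `B`-linear.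
  obtain ⟨U, hUc, hU⟩ := CPTensor.exists_unitary_of_tmul (B := B) (X := X)
    (starHomToCP (leftMul B))
    (LinearMap.mk₂ ℂ (fun (x : X) (b : B) => rsmul x b) add_rsmul smul_rsmul rsmul_add
      fun c x b => rsmul_smul c x b)
    (fun x x' b b' => by
      change ip (rsmul x b) (rsmul x' b') = star b * (ip x x' * b')
      rw [ip_rsmul_left, ip_rsmul_right]) (dense_span_rsmul B X)
  refine ⟨U, fun T z => ?_⟩
  refine CPTensor.denseRange_mk.induction_on (p := fun z =>
    U (ampliate X (starHomToCP (leftMul B)) T z) = T (U z)) z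
    (isClosed_eq (hUc.comp (map_continuous _)) ((map_continuous _).comp hUc)) fun t => ?_
  induction t using TensorProduct.induction_on with
  | zero => simp
  | add s t hs ht => simp only [map_add, hs, ht]
  | tmul x b =>
    rw [ampliate_tmul, hU, hU]
    exact (T.map_rsmul x b).symm

end Unit

/-! ### Countably generated modules -/

section CountablyGenerated

variable {A B X Y : Type*} [NonUnitalCStarAlgebra A] [PartialOrder A] [StarOrderedRing A]
  [NonUnitalCStarAlgebra B] [PartialOrder B] [StarOrderedRing B]
  [NormedAddCommGroup X] [NormedSpace ℂ X] [HilbertModule A X]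
  [NormedAddCommGroup Y] [NormedSpace ℂ Y] [HilbertModule B Y] [CompleteSpace Y]

-- A countable dense set generates. Since `A` may lack a unit, its elements need not themselves lie
-- in the span of their multiples, so the argument goes through all products xb, which are total,
-- and approximates the factor x.
variable (A) in
lemma isCountablyGeneratedModule_self [TopologicalSpace.SeparableSpace A] :
    IsCountablyGeneratedModule A A := by
  obtain ⟨D, hDc, hD⟩ := TopologicalSpace.exists_countable_dense A
  refine ⟨D, hDc, ?_⟩
  -- It is enough that the closure of the span is dense, which leaves room for the approximation of
  -- `x` by elements of `D`.
  rw [← dense_closure, ← Submodule.topologicalClosure_coe]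
  refine (dense_span_rsmul A A).mono (Submodule.span_le.2 ?_)
  rintro _ ⟨x, b, rfl⟩
  exact map_mem_closure (f := fun x : A => x * b) (continuous_mul_const b) (hD x)
    fun d hd => Submodule.subset_span ⟨d, hd, b, rfl⟩

/-- The vectors x·a ⊗ y·b, with x and y among the generators, are total. For completely positive ρ
the element a need not move across the tensor sign, so it is made part of the generator and
restricted to a countable dense set of `A`; b is supplied by the right action. -/
lemma IsCountablyGeneratedModule.cpTensor [TopologicalSpace.SeparableSpace A]
    (hX : IsCountablyGeneratedModule A X) (hY : IsCountablyGeneratedModule B Y)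
    (ρ : A →CP Adj B Y) : IsCountablyGeneratedModule B (CPTensor X ρ) := by
  obtain ⟨D, hDc, hD⟩ := TopologicalSpace.exists_countable_dense A
  obtain ⟨S, hSc, hS⟩ := hX
  obtain ⟨T, hTc, hT⟩ := hY
  refine ⟨(fun p : X × A × Y => CPTensor.mk X ρ (rsmul p.1 p.2.1 ⊗ₜ p.2.2)) '' (S ×ˢ D ×ˢ T),
    (hSc.prod (hDc.prod hTc)).image _, ?_⟩
  refine CPTensor.dense_of_tmul_mem_closure hS hT _ ?_
  rintro _ ⟨x, hx, a, rfl⟩ _ ⟨y, hy, b, rfl⟩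
  -- Boundedness of a ↦ x·a makes a ↦ x·a ⊗ y·b continuous, so that `a` can be approximated from
  -- `D`.
  let r : A →L[ℂ] X := LinearMap.mkContinuous
    { toFun := fun a => rsmul x a
      map_add' := rsmul_add x
      map_smul' := fun c a => rsmul_smul c x a } ‖x‖ fun a => norm_rsmul_le x a
  have hc : Continuous fun a : A => CPTensor.mk X ρ (rsmul x a ⊗ₜ rsmul y b) :=
    ((CPTensor.tmulL X ρ).flip (rsmul y b)).continuous.comp r.continuous
  exact map_mem_closure (f := fun a : A => CPTensor.mk X ρ (rsmul x a ⊗ₜ rsmul y b)) hc (hD a) fun d hd => Submodule.subset_span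
    ⟨_, ⟨(x, d, y), ⟨hx, hd, hy⟩, rfl⟩, b, (CPTensor.rsmul_tmul _ _ _).symm⟩

end CountablyGenerated

/-! ### The laws of the two compositions -/

section Laws

variable {A B C D : CStarAlg.{u}}

lemma Corr.id_comp (E : Corr A B) : (Corr.id A).comp E ≈ E :=
  CPTensor.exists_leftUnitor E.nondegenerate

lemma Corr.comp_id (E : Corr A B) : E.comp (Corr.id B) ≈ E := by
  obtain ⟨U, hU⟩ := CPTensor.exists_rightUnitor B E.X
  exact ⟨U, Intertwines.of_apply fun a z => hU (E.φ a) z⟩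

lemma Corr.comp_assoc (E : Corr A B) (F : Corr B C) (G : Corr C D) :
    (E.comp F).comp G ≈ E.comp (F.comp G) := by
  obtain ⟨U, hU⟩ := CPTensor.exists_assoc (X := E.X) (starHomToCP F.φ) (starHomToCP G.φ)
  exact ⟨U, Intertwines.of_apply fun a z => hU (E.φ a) z⟩

/-- The KSGNS correspondence of a homomorphism is by definition its composite with the identity
correspondence on the left, so this is the left identity law again. -/
lemma Corr.ksgns_toPosCorr (E : Corr A B) : E.toPosCorr.ksgns ≈ E :=
  CPTensor.exists_leftUnitor E.nondegenerate

/-- The Quesadilla composite tensors `E` with the KSGNS correspondence of `F`, which is isomorphic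
to `F`. Isomorphism of positive correspondences unfolds here to isomorphism of correspondences, so
congruence of the balanced tensor product applies. -/
lemma Corr.toPosCorr_comp (E : Corr A B) (F : Corr B C) :
    (E.comp F).toPosCorr ≈ E.toPosCorr.comp F.toPosCorr :=
  Corr.comp_congr (Setoid.refl E) (Setoid.symm F.ksgns_toPosCorr)

/-- This is the associator with `A` as first factor: (A ⊗_ρ X) ⊗_B K(Q) ≅ A ⊗_{ρ⊗1} (X ⊗_B K(Q)),
where K(Q) is the KSGNS correspondence of `Q`. It respects the left actions because it commutes with
all adjointable operators on `A`, in particular left multiplications. -/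
lemma PosCorr.ksgns_comp (P : PosCorr A B) (Q : PosCorr B C) :
    (P.comp Q).ksgns ≈ P.ksgns.comp Q.ksgns := by
  obtain ⟨U, hU⟩ := CPTensor.exists_assoc (X := A) P.ρ (starHomToCP Q.ksgns.φ)
  exact Setoid.symm ⟨U, Intertwines.of_apply fun a z => hU (leftMul A a) z⟩

lemma PosCorr.comp_assoc (P : PosCorr A B) (Q : PosCorr B C) (R : PosCorr C D) :
    (P.comp Q).comp R ≈ P.comp (Q.comp R) := by
  obtain ⟨U, hU⟩ := CPTensor.exists_assoc (X := P.X) (starHomToCP Q.ksgns.φ)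
    (starHomToCP R.ksgns.φ)
  -- The associator ends in P ⊗ (K(Q) ⊗ K(R)), K denoting the KSGNS construction, whereas the goal
  -- is P ⊗ K(QR). Multiplicativity of K supplies the unitary `W` for the second leg.
  obtain ⟨W, hW⟩ := Setoid.symm (PosCorr.ksgns_comp Q R)
  have hW' : Intertwines W (starHomToCP (Q.ksgns.comp R.ksgns).φ)
    (starHomToCP (Q.comp R).ksgns.φ) := hW
  have h₁ : Intertwines U ((P.comp Q).comp R).ρ
      (P.ρ.starComp (ampliate P.X (starHomToCP (Q.ksgns.comp R.ksgns).φ))) :=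
    Intertwines.of_apply fun a z => hU (P.ρ a) z
  exact ⟨U.trans (CPTensor.congr (ModuleUnitary.refl B P.X) W hW'), h₁.trans
    (Intertwines.of_apply fun a z => CPTensor.congr_intertwines (ModuleUnitary.refl B P.X) W hW'
      (φ := P.ρ) (φ' := P.ρ) (fun _ _ => rfl) a z)⟩

end Laws

end

/-! ### The proposition, on isomorphism classes -/

theorem mainTheorem1 :
    -- Quesadilla is a semi-category, and Enchilada is a category
    IsSemiCategory Quesadilla.{u} ∧
    IsSemiCategory Enchilada.{u} ∧
    (∀ {A B : Enchilada.{u}} (f : A ⟶ B),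
      Compositional.comp (Enchilada.id A) f = f ∧ Compositional.comp f (Enchilada.id B) = f) ∧
    -- KSGNS is a semi-functor, with `KSGNS(A) = A` and `KSGNS[(ρ, X)] = [(π_ρ, A ⊗_ρ X)]`;
    -- it fixes the classes of nondegenerate correspondences and is onto
    IsSemiFunctor KSGNS.{u} ∧
    (∀ A : Quesadilla.{u}, KSGNS.{u}.obj A = A) ∧
    (∀ {A B : CStarAlg.{u}} (P : PosCorr A B),
      KSGNS.{u}.map (Quesadilla.mk P) = Enchilada.mk P.ksgns) ∧
    (∀ {A B : CStarAlg.{u}} (E : Corr A B),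
      KSGNS.{u}.map (Quesadilla.mk E.toPosCorr) = Enchilada.mk E) ∧
    (∀ A B : Quesadilla.{u},
      Function.Surjective fun f : A ⟶ B => KSGNS.{u}.map f) ∧
    -- U is a semi-functor, with `U(A) = A` and `U[(φ, X)] = [(φ, X)]`
    IsSemiFunctor forgetful.{u} ∧
    (∀ A : Enchilada.{u}, forgetful.{u}.obj A = A) ∧
    (∀ {A B : CStarAlg.{u}} (E : Corr A B),
      forgetful.{u}.map (Enchilada.mk E) = Quesadilla.mk E.toPosCorr) ∧
    -- `KSGNS ∘ U = Id`, and `U ∘ KSGNS` is idempotent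
    forgetful.{u} ⋙q KSGNS.{u} = 𝟭q Enchilada.{u} ∧
    (KSGNS.{u} ⋙q forgetful.{u}) ⋙q (KSGNS.{u} ⋙q forgetful.{u}) =
      KSGNS.{u} ⋙q forgetful.{u} ∧
    -- everything restricts to separable algebras and countably generated modules
    (∀ A B C : CStarAlg.{u}, TopologicalSpace.SeparableSpace A →
      TopologicalSpace.SeparableSpace B → TopologicalSpace.SeparableSpace C →
      IsCountablyGeneratedModule A (Corr.id A).X ∧
      (∀ P : PosCorr A B, IsCountablyGeneratedModule B P.X → IsCountablyGeneratedModule B P.ksgns.X) ∧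
      (∀ (P : PosCorr A B) (Q : PosCorr B C), IsCountablyGeneratedModule B P.X →
        IsCountablyGeneratedModule C Q.X → IsCountablyGeneratedModule C (P.comp Q).X) ∧
      (∀ (E : Corr A B) (F : Corr B C), IsCountablyGeneratedModule B E.X →
        IsCountablyGeneratedModule C F.X → IsCountablyGeneratedModule C (E.comp F).X)) := by
  have hKU : ∀ {A B : CStarAlg.{u}} (E : Corr A B),
      KSGNS.{u}.map (Quesadilla.mk E.toPosCorr) = Enchilada.mk E :=
    fun E => Quotient.sound E.ksgns_toPosCorr
  have hUK : forgetful.{u} ⋙q KSGNS.{u} = 𝟭q Enchilada.{u} :=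
    Prefunctor.ext (fun _ => rfl) fun A B f => Quotient.inductionOn f fun E => hKU E
  refine ⟨fun f g h => ?_, fun f g h => ?_, fun f => ?_, fun f g => ?_, fun _ => rfl,
    fun _ => rfl, hKU, fun A B f => ?_, fun f g => ?_, fun _ => rfl, fun _ => rfl, hUK, ?_, ?_⟩
  · exact Quotient.inductionOn₃ f g h fun P Q R => Quotient.sound (P.comp_assoc Q R)
  · exact Quotient.inductionOn₃ f g h fun E F G => Quotient.sound (E.comp_assoc F G)
  · exact Quotient.inductionOn f fun E => ⟨Quotient.sound E.id_comp, Quotient.sound E.comp_id⟩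
  · exact Quotient.inductionOn₂ f g fun P Q => Quotient.sound (P.ksgns_comp Q)
  · exact Quotient.inductionOn f fun E => ⟨Quesadilla.mk E.toPosCorr, hKU E⟩
  · exact Quotient.inductionOn₂ f g fun E F => Quotient.sound (E.toPosCorr_comp F)
  · change KSGNS ⋙q (forgetful ⋙q KSGNS) ⋙q forgetful = KSGNS ⋙q forgetful
    rw [hUK]
    rfl
  · intro A B C _ _ _
    have hA : IsCountablyGeneratedModule A A := isCountablyGeneratedModule_self A
    have hB : IsCountablyGeneratedModule B B := isCountablyGeneratedModule_self B
    -- In the Quesadilla composite the inner factor B ⊗_σ Y is countably generated because `B` is;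
    -- tensoring it with `P.X` over the separable algebra `B` preserves this.
    exact ⟨hA, fun P hP => hA.cpTensor hP _, fun P Q hP hQ => hP.cpTensor (hB.cpTensor hQ _) _,
      fun E F hE hF => hE.cpTensor hF _⟩
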